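/- Let $N\ge 2$, let $\Omega\subseteq\mathbb R^N$ be open, bounded, connected (nonempty) and Lipschitz (near each boundary point, up to a rigid motion, $\Omega$ is the part above the graph of a Lipschitz function), and let $c\in L^\infty(\mathbb R^N)$ satisfy $c\ge c_0$ a.e. for some constant $c_0>0$. Let $H^1(\Omega)$ be the Sobolev space of real functions $u\in L^2(\Omega)$ with weak gradient in $L^2(\Omega;\mathbb R^N)$, with norm $\|u\|_{H^1(\Omega)}=\big(\int_\Omega(|\nabla u|^2+u^2)\,dx\big)^{1/2}$. For a compact set $K\subseteq\overline\Omega$ let $H^1_{0,K}(\Omega)$ be the closure in $H^1(\Omega)$ of $C_c^\infty(\overline\Omega\setminus K)$, that is, of the restrictions to $\Omega$ of functions in $C_c^\infty(\mathbb R^N)$ whose support does not meet $K$. Let $$\mathrm{Cap}_{\overline\Omega}(K)=\inf\Big\{\int_\Omega(|\nabla u|^2+u^2)\,dx:\ u\in H^1(\Omega),\ u-1\in H^1_{0,K}(\Omega)\Big\},$$ and let $$q(u,v)=\int_\Omega(\nabla u\cdot\nabla v+c\,uv)\,dx,\qquad u,v\in H^1(\Omega).$$ A number $\lambda\in\mathbb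 R$ is an eigenvalue of the restriction of $q$ to $H^1_{0,K}(\Omega)$, with eigenfunction $u\in H^1_{0,K}(\Omega)\setminus\{0\}$, if $q(u,v)=\lambda\int_\Omega uv\,dx$ for all $v\in H^1_{0,K}(\Omega)$. For $n\ge 1$ let $\lambda_n(\Omega;K)$ be the $n$-th such eigenvalue, in increasing order and counted with multiplicity (i.e. the least $t$ such that at least $n$ linearly independent eigenfunctions have eigenvalue at most $t$), with $\lambda_n(\Omega;K)=+\infty$ if there are fewer than $n$ eigenvalues; the latter happens only for $K=\overline\Omega$, when $H^1_{0,K}(\Omega)=\{0\}$. Put $\lambda_n:=\lambda_n(\Omega;\emptyset)$. Then, for every compact $K\subseteq\overline\Omega$, the following three assertions are equivalent: (i) $\mathrm{Cap}_{\overline\Omega}(K)=0$; (ii) $H^1_{0,K}(\Omega)=H^1(\Omega)$; (iii) $\lambda_n(\Omega;K)=\lambda_n$ for every integer $n\ge1$. -/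

import Mathlib

open MeasureTheory
open scoped ContDiff

noncomputable section

namespace MixedEigen

/-- Euclidean space `ℝ^N`. -/
abbrev Eucl (N : ℕ) : Type := EuclideanSpace ℝ (Fin N)

/-- `Ω` is a Lipschitz set: near every boundary point `x` there are a direction `e` (the
"vertical axis") and a Lipschitz function `γ` on the hyperplane orthogonal to `e` such that, in a
ball around `x`, the set `Ω` is the part lying strictly above the graph of `γ`. -/
def IsLipschitzSet {N : ℕ} (Ω : Set (Eucl N)) : Prop :=
  ∀ x ∈ frontier Ω, ∃ r : ℝ, 0 < r ∧ ∃ e : Eucl N, ‖e‖ = 1 ∧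
    ∃ (γ : (Submodule.span ℝ {e})ᗮ → ℝ) (L : NNReal), LipschitzWith L γ ∧
      ∀ y ∈ Metric.ball x r,
        y ∈ Ω ↔ γ ((Submodule.span ℝ {e})ᗮ.orthogonalProjectionOnto y) < inner ℝ e y

/-- `L²(Ω)`. -/
abbrev L2 {N : ℕ} (Ω : Set (Eucl N)) : Type := Lp ℝ 2 (volume.restrict Ω)

/-- `L²(Ω; ℝ^N)`. -/
abbrev L2Vec {N : ℕ} (Ω : Set (Eucl N)) : Type := Lp (Eucl N) 2 (volume.restrict Ω)

/-- `φ ∈ C_c^∞(Ω)`. -/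
structure IsTestFunction {N : ℕ} (Ω : Set (Eucl N)) (φ : Eucl N → ℝ) : Prop where
  smooth : ContDiff ℝ ∞ φ
  compact : HasCompactSupport φ
  supp : tsupport φ ⊆ Ω

/-- `g` is the weak gradient of `u` in `Ω`: for all `φ ∈ C_c^∞(Ω)` and all directions `v`,
`∫_Ω u ∂_v φ = - ∫_Ω (g · v) φ`. -/
def IsWeakGradient {N : ℕ} (Ω : Set (Eucl N)) (u : L2 Ω) (g : L2Vec Ω) : Prop :=
  ∀ φ : Eucl N → ℝ, IsTestFunction Ω φ → ∀ v : Eucl N,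
    ∫ x in Ω, u x * fderiv ℝ φ x v = -∫ x in Ω, inner ℝ (g x) v * φ x

theorem IsTestFunction.memLp {N : ℕ} {Ω : Set (Eucl N)} {φ : Eucl N → ℝ}
    (h : IsTestFunction Ω φ) : MemLp φ 2 (volume.restrict Ω) :=
  (h.smooth.continuous.memLp_of_hasCompactSupport h.compact).restrict Ω

theorem IsTestFunction.memLp_fderiv {N : ℕ} {Ω : Set (Eucl N)} {φ : Eucl N → ℝ}
    (h : IsTestFunction Ω φ) (v : Eucl N) :
    MemLp (fun x => fderiv ℝ φ x v) 2 (volume.restrict Ω) := by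
  have hc : Continuous (fun x => fderiv ℝ φ x v) :=
    (h.smooth.continuous_fderiv (by simp)).clm_apply continuous_const
  exact (hc.memLp_of_hasCompactSupport (h.compact.fderiv_apply (𝕜 := ℝ) v)).restrict Ω

theorem IsTestFunction.integrable_left {N : ℕ} {Ω : Set (Eucl N)} {φ : Eucl N → ℝ}
    (h : IsTestFunction Ω φ) (u : L2 Ω) (v : Eucl N) :
    Integrable (fun x => u x * fderiv ℝ φ x v) (volume.restrict Ω) :=
  (Lp.memLp u).integrable_mul (h.memLp_fderiv v)

theorem IsTestFunction.integrable_right {N : ℕ} {Ω : Set (Eucl N)} {φ : Eucl N → ℝ}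
    (h : IsTestFunction Ω φ) (g : L2Vec Ω) (v : Eucl N) :
    Integrable (fun x => inner ℝ (g x) v * φ x) (volume.restrict Ω) :=
  ((Lp.memLp g).inner_const v).integrable_mul h.memLp

theorem IsWeakGradient.zero {N : ℕ} (Ω : Set (Eucl N)) :
    IsWeakGradient Ω (0 : L2 Ω) (0 : L2Vec Ω) := by
  intro φ _ v
  have h1 : ∫ x in Ω, (0 : L2 Ω) x * fderiv ℝ φ x v = 0 := by
    refine integral_eq_zero_of_ae ?_
    filter_upwards [Lp.coeFn_zero ℝ 2 (volume.restrict Ω)] with x hx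
    rw [hx]; simp
  have h2 : ∫ x in Ω, inner ℝ ((0 : L2Vec Ω) x) v * φ x = 0 := by
    refine integral_eq_zero_of_ae ?_
    filter_upwards [Lp.coeFn_zero (Eucl N) 2 (volume.restrict Ω)] with x hx
    rw [hx]; simp
  rw [h1, h2, neg_zero]

theorem IsWeakGradient.add {N : ℕ} {Ω : Set (Eucl N)} {u u' : L2 Ω} {g g' : L2Vec Ω}
    (h : IsWeakGradient Ω u g) (h' : IsWeakGradient Ω u' g') :
    IsWeakGradient Ω (u + u') (g + g') := by
  intro φ hφ v
  have h1 : ∫ x in Ω, (u + u') x * fderiv ℝ φ x v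
      = ∫ x in Ω, (u x * fderiv ℝ φ x v + u' x * fderiv ℝ φ x v) := by
    refine integral_congr_ae ?_
    filter_upwards [Lp.coeFn_add u u'] with x hx
    rw [hx, Pi.add_apply, add_mul]
  have h2 : ∫ x in Ω, inner ℝ ((g + g') x) v * φ x
      = ∫ x in Ω, (inner ℝ (g x) v * φ x + inner ℝ (g' x) v * φ x) := by
    refine integral_congr_ae ?_
    filter_upwards [Lp.coeFn_add g g'] with x hx
    rw [hx, Pi.add_apply, inner_add_left, add_mul]
  rw [h1, h2, integral_add (hφ.integrable_left u v) (hφ.integrable_left u' v),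
    integral_add (hφ.integrable_right g v) (hφ.integrable_right g' v), h φ hφ v, h' φ hφ v, neg_add]

theorem IsWeakGradient.smul {N : ℕ} {Ω : Set (Eucl N)} (a : ℝ) {u : L2 Ω} {g : L2Vec Ω}
    (h : IsWeakGradient Ω u g) : IsWeakGradient Ω (a • u) (a • g) := by
  intro φ hφ v
  have h1 : ∫ x in Ω, (a • u) x * fderiv ℝ φ x v
      = ∫ x in Ω, a * (u x * fderiv ℝ φ x v) := by
    refine integral_congr_ae ?_
    filter_upwards [Lp.coeFn_smul a u] with x hx
    rw [hx, Pi.smul_apply, smul_eq_mul, mul_assoc]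
  have h2 : ∫ x in Ω, inner ℝ ((a • g) x) v * φ x
      = ∫ x in Ω, a * (inner ℝ (g x) v * φ x) := by
    refine integral_congr_ae ?_
    filter_upwards [Lp.coeFn_smul a g] with x hx
    rw [hx, Pi.smul_apply, real_inner_smul_left, mul_assoc]
  rw [h1, h2, integral_const_mul, integral_const_mul, h φ hφ v, mul_neg]

/-- The Sobolev space `H¹(Ω)`, realized as the space of pairs `(u, ∇u)` with `u ∈ L²(Ω)` and
weak gradient `∇u ∈ L²(Ω; ℝ^N)`. The norm inherited from the Hilbert sum
`L²(Ω) ⊕ L²(Ω; ℝ^N)` is `(∫_Ω |∇u|² + u²)^{1/2}`. -/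
def H1 {N : ℕ} (Ω : Set (Eucl N)) : Submodule ℝ (WithLp 2 (L2 Ω × L2Vec Ω)) where
  carrier := {p | IsWeakGradient Ω p.fst p.snd}
  zero_mem' := IsWeakGradient.zero Ω
  add_mem' := fun h h' => IsWeakGradient.add h h'
  smul_mem' := fun a _ h => IsWeakGradient.smul a h

/-- The underlying function of an element of `H¹(Ω)`. -/
def H1.val {N : ℕ} {Ω : Set (Eucl N)} (u : H1 Ω) : L2 Ω := (u : WithLp 2 (L2 Ω × L2Vec Ω)).fst

/-- The weak gradient of an element of `H¹(Ω)`. -/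
def H1.grad {N : ℕ} {Ω : Set (Eucl N)} (u : H1 Ω) : L2Vec Ω :=
  (u : WithLp 2 (L2 Ω × L2Vec Ω)).snd

/-- `C_c^∞(Ω̄ ∖ K)` as a subspace of `H¹(Ω)`: the (classes of) restrictions to `Ω` of smooth
compactly supported functions on `ℝ^N` whose support does not meet `K`. -/
def smoothAwayFrom {N : ℕ} (Ω K : Set (Eucl N)) : Submodule ℝ (H1 Ω) where
  carrier := {u | ∃ φ : Eucl N → ℝ, ContDiff ℝ ∞ φ ∧ HasCompactSupport φ ∧
    Disjoint (tsupport φ) K ∧ H1.val u =ᵐ[volume.restrict Ω] φ}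
  zero_mem' := ⟨0, contDiff_const, HasCompactSupport.zero, by simp [tsupport],
    Lp.coeFn_zero ℝ 2 (volume.restrict Ω)⟩
  add_mem' := by
    rintro u w ⟨φ, h1, h2, h3, h4⟩ ⟨ψ, k1, k2, k3, k4⟩
    refine ⟨φ + ψ, h1.add k1, h2.add k2,
      (h3.union_left k3).mono_left (tsupport_add φ ψ), ?_⟩
    exact (Lp.coeFn_add (H1.val u) (H1.val w)).trans (h4.add k4)
  smul_mem' := by
    rintro a u ⟨φ, h1, h2, h3, h4⟩
    refine ⟨a • φ, contDiff_const.smul h1, h2.smul_left (f := fun _ => a),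
      h3.mono_left (closure_mono (Function.support_const_smul_subset a φ)), ?_⟩
    exact (Lp.coeFn_smul a (H1.val u)).trans (h4.const_smul a)

/-- `H¹_{0,K}(Ω)`: the closure of `C_c^∞(Ω̄ ∖ K)` in `H¹(Ω)`. -/
def H10 {N : ℕ} (Ω K : Set (Eucl N)) : Submodule ℝ (H1 Ω) :=
  (smoothAwayFrom Ω K).topologicalClosure

/-- The relative Sobolev capacity of `K` in `Ω̄`: the infimum of `∫_Ω (|∇u|² + u²)` over
`u ∈ H¹(Ω)` with `u - 1 ∈ H¹_{0,K}(Ω)`. -/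
def relCapacity {N : ℕ} (Ω K : Set (Eucl N)) : ℝ :=
  sInf {t : ℝ | ∃ u : H1 Ω,
    (∃ w ∈ H10 Ω K, H1.val w =ᵐ[volume.restrict Ω] fun x => H1.val u x - 1) ∧
    t = ∫ x in Ω, (‖H1.grad u x‖ ^ 2 + (H1.val u x) ^ 2)}

/-- The bilinear form `q(u,v) = ∫_Ω (∇u · ∇v + c u v)` on `H¹(Ω)`. -/
def qForm {N : ℕ} (Ω : Set (Eucl N)) (c : Eucl N → ℝ) (u v : H1 Ω) : ℝ :=
  ∫ x in Ω, (inner ℝ (H1.grad u x) (H1.grad v x) + c x * H1.val u x * H1.val v x)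

/-- `u` is an eigenfunction, with eigenvalue `μ`, of the restriction of `q` to `H¹_{0,K}(Ω)`. -/
def IsEigenfunction {N : ℕ} (Ω : Set (Eucl N)) (c : Eucl N → ℝ) (K : Set (Eucl N)) (μ : ℝ)
    (u : H1 Ω) : Prop :=
  u ∈ H10 Ω K ∧ u ≠ 0 ∧
    ∀ v ∈ H10 Ω K, qForm Ω c u v = μ * ∫ x in Ω, H1.val u x * H1.val v x

/-- `λ_n(Ω;K)` (for `n ≥ 1`): the `n`-th eigenvalue of the restriction of `q` to `H¹_{0,K}(Ω)`,
in increasing order and counted with multiplicity, that is, the least `t` such that at least `n`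
linearly independent eigenfunctions have eigenvalue at most `t`. The value is `+∞` if there are
fewer than `n` eigenvalues (this concerns only `K = Ω̄`, where `H¹_{0,K}(Ω) = 0`). -/
def eigenvalue {N : ℕ} (Ω : Set (Eucl N)) (c : Eucl N → ℝ) (K : Set (Eucl N)) (n : ℕ) : EReal :=
  sInf ((fun t : ℝ => (t : EReal)) '' {t : ℝ | ∃ e : Fin n → H1 Ω, LinearIndependent ℝ e ∧
    ∀ i, ∃ μ ≤ t, IsEigenfunction Ω c K μ (e i)})

end MixedEigen

end

/-! Capacity and density are linked through the constant 1. An admissible function has the form 1 +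
w with w in `H10 Ω K`, so zero capacity means that 1 lies in this closed subspace. The subspace is
stable under multiplication by smooth compactly supported φ, hence it then contains every
restriction φ = φ · 1, and these are dense in H¹(Ω) (`H10_empty`). Conversely, if the subspace is
everything, then u = 0 is admissible.

That equal eigenvalues force equality of the spaces is an abstract fact about a symmetric coercive
form and a compact injective embedding (`eq_top_of_formEigenvalue_eq`). Let W be closed and proper.
The eigenvectors of the full form span a dense subspace, so one of them is missing from W; let l be
the least eigenvalue having an eigenvector outside W. Eigenvectors below l are inherited by W. A
vector in the spectral space of W up to l that is q-orthogonal to them has Rayleigh quotient at most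
l, while l is a lower bound on that complement; being a minimizer, it is an eigenvector of the full
form. So the spectral space of W up to l is strictly smaller than the full one. If n is the
dimension of the latter, the n-th eigenvalue on W exceeds l and the full one does not.

Density and compactness of H¹(Ω) → L²(Ω) (`isCompactOperator_valL`) rest on one device. Near each
point of the closure, the Lipschitz condition yields an open set of directions pointing into Ω;
convolution with a kernel supported on the opposite side reads u only inside Ω. After a cutoff it
converges to u in H¹, it differs from u in L² by at most δ‖u‖, and for a fixed kernel it is a
Hilbert–Schmidt operator. -/

noncomputable section

namespace MixedEigen

open Filter Topology

/-! ### Spectral theory of a coercive form relative to a compact embedding -/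

section AbstractSpectral

variable {V H : Type*} [NormedAddCommGroup V] [InnerProductSpace ℝ V]
  [NormedAddCommGroup H] [InnerProductSpace ℝ H]

/-- `u` is an eigenvector, with eigenvalue `μ`, of the restriction to `W` of the form `q`, relative
to the semi-inner product induced by `J`. -/
def IsFormEigenvector (q : V →L[ℝ] V →L[ℝ] ℝ) (J : V →L[ℝ] H) (W : Submodule ℝ V) (μ : ℝ)
    (u : V) : Prop :=
  u ∈ W ∧ u ≠ 0 ∧ ∀ v ∈ W, q u v = μ * inner ℝ (J u) (J v)

/-- The span of the eigenvectors on `W` with eigenvalue at most `t`. -/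
def spectralSpan (q : V →L[ℝ] V →L[ℝ] ℝ) (J : V →L[ℝ] H) (W : Submodule ℝ V) (t : ℝ) :
    Submodule ℝ V :=
  Submodule.span ℝ {u | ∃ μ ≤ t, IsFormEigenvector q J W μ u}

/-- The `n`-th eigenvalue of the restriction of `q` to `W`, counted with multiplicity. -/
def formEigenvalue (q : V →L[ℝ] V →L[ℝ] ℝ) (J : V →L[ℝ] H) (W : Submodule ℝ V) (n : ℕ) : EReal :=
  sInf ((fun t : ℝ => (t : EReal)) '' {t : ℝ | ∃ e : Fin n → V, LinearIndependent ℝ e ∧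
    ∀ i, ∃ μ ≤ t, IsFormEigenvector q J W μ (e i)})

variable {q : V →L[ℝ] V →L[ℝ] ℝ} {J : V →L[ℝ] H}

/-- First variation. Perturbing v by s • u, rather than u by v, makes the quadratic term in s
nonpositive, so an affine function of s is nonnegative everywhere and its slope vanishes. -/
theorem form_eq_of_minimizer (hsymm : ∀ u v, q u v = q v u) {Y : Submodule ℝ V} {m : ℝ}
    (hm : ∀ v ∈ Y, m * ‖J v‖ ^ 2 ≤ q v v) {u : V} (hu : u ∈ Y) (hle : q u u ≤ m * ‖J u‖ ^ 2) :
    ∀ v ∈ Y, q u v = m * inner ℝ (J u) (J v) := by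
  intro v hv
  have key : ∀ s : ℝ, 0 ≤ (q v v - m * ‖J v‖ ^ 2)
      + s * (2 * (q u v - m * inner ℝ (J u) (J v))) := by
    intro s
    have h := hm (v + s • u) (Y.add_mem hv (Y.smul_mem s hu))
    have h1 : q (v + s • u) (v + s • u) = q v v + 2 * s * q u v + s ^ 2 * q u u := by
      simp only [map_add, map_smul, _root_.add_apply, _root_.smul_apply,
        smul_eq_mul]
      rw [hsymm v u]; ring
    have h2 : ‖J (v + s • u)‖ ^ 2
        = ‖J v‖ ^ 2 + 2 * s * inner ℝ (J u) (J v) + s ^ 2 * ‖J u‖ ^ 2 := by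
      rw [map_add, map_smul, norm_add_sq_real, real_inner_smul_right, norm_smul, mul_pow,
        Real.norm_eq_abs, sq_abs, real_inner_comm]
      ring
    rw [h1, h2] at h
    nlinarith [mul_nonneg (sq_nonneg s) (sub_nonneg.2 hle)]
  by_contra hne
  have hne' : 2 * (q u v - m * inner ℝ (J u) (J v)) ≠ 0 := by
    intro h; apply hne; linarith
  -- This s makes the affine function equal to -1.
  have h := key (-((q v v - m * ‖J v‖ ^ 2) + 1) / (2 * (q u v - m * inner ℝ (J u) (J v))))
  rw [div_mul_cancel₀ _ hne'] at h
  linarith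

/-- Direct method without weak convergence: a normalized minimizing sequence is bounded by
coercivity, compactness makes its images under J converge along a subsequence, and the parallelogram
law upgrades this to convergence in V. -/
theorem exists_form_minimizer [CompleteSpace V]
    (hcoer : IsCoercive q) (hJ : IsCompactOperator J) (hinj : Function.Injective J)
    {Y : Submodule ℝ V} (hY : IsClosed (Y : Set V)) (hne : Y ≠ ⊥) :
    ∃ m : ℝ, (∀ v ∈ Y, m * ‖J v‖ ^ 2 ≤ q v v) ∧
      ∃ u ∈ Y, u ≠ 0 ∧ q u u ≤ m * ‖J u‖ ^ 2 := by
  obtain ⟨C, hC, hcoer⟩ := hcoer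
  have hJ0 : ∀ v, v ≠ 0 → ‖J v‖ ≠ 0 := fun v hv h =>
    hv (hinj (by rw [norm_eq_zero.1 h, map_zero]))
  have hqn : ∀ v, 0 ≤ q v v := fun v => le_trans (by positivity) (hcoer v)
  set R : Set ℝ := {r | ∃ u ∈ Y, ‖J u‖ = 1 ∧ r = q u u} with hR
  have hmem : ∀ v ∈ Y, v ≠ 0 → q v v / ‖J v‖ ^ 2 ∈ R := by
    intro v hv hv0
    refine ⟨‖J v‖⁻¹ • v, Y.smul_mem _ hv, ?_, ?_⟩
    · rw [map_smul, norm_smul, norm_inv, norm_norm, inv_mul_cancel₀ (hJ0 v hv0)]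
    · simp only [map_smul, _root_.smul_apply, smul_eq_mul]
      field_simp
  have hbdd : BddBelow R := ⟨0, by rintro r ⟨u, -, -, rfl⟩; exact hqn u⟩
  obtain ⟨v0, hv0Y, hv0⟩ := Submodule.exists_mem_ne_zero_of_ne_bot hne
  have hRne : R.Nonempty := ⟨_, hmem v0 hv0Y hv0⟩
  set m := sInf R
  have hm0 : 0 ≤ m := le_csInf hRne (by rintro r ⟨u, -, -, rfl⟩; exact hqn u)
  have hm : ∀ v ∈ Y, m * ‖J v‖ ^ 2 ≤ q v v := by
    intro v hv
    by_cases h0 : v = 0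
    · simp [h0]
    · have h := csInf_le hbdd (hmem v hv h0)
      have hp : 0 < ‖J v‖ ^ 2 := by have := hJ0 v h0; positivity
      rwa [le_div_iff₀ hp] at h
  refine ⟨m, hm, ?_⟩
  have hseq : ∀ n : ℕ, ∃ u ∈ Y, ‖J u‖ = 1 ∧ q u u ≤ m + 1 / ((n : ℝ) + 1) := by
    intro n
    obtain ⟨r, ⟨u, h1, h2, rfl⟩, h3⟩ := exists_lt_of_csInf_lt hRne
      (show sInf R < m + 1 / ((n : ℝ) + 1) from lt_add_of_pos_right _ (by positivity))
    exact ⟨u, h1, h2, h3.le⟩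
  choose u huY hu1 huq using hseq
  have hball : ∀ n, u n ∈ Metric.closedBall (0 : V) (Real.sqrt ((m + 1) / C)) := by
    intro n
    rw [mem_closedBall_zero_iff]
    apply Real.le_sqrt_of_sq_le
    rw [le_div_iff₀ hC]
    have h1 := hcoer (u n)
    have h2 := huq n
    have h3 : 1 / ((n : ℝ) + 1) ≤ 1 := by
      rw [div_le_one (by positivity)]; linarith [(n.cast_nonneg : (0 : ℝ) ≤ n)]
    nlinarith
  obtain ⟨S, hS, hsub⟩ := IsCompactOperator.image_closedBall_subset_compact (f := (J : V →ₗ[ℝ] H)) hJ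
    (Real.sqrt ((m + 1) / C))
  obtain ⟨h, -, φ, hφ, hlim⟩ := hS.tendsto_subseq (x := fun n => J (u n))
    (fun n => hsub ⟨u n, hball n, rfl⟩)
  have hone : Tendsto (fun n => 1 / (((φ n : ℕ) : ℝ) + 1)) atTop (𝓝 0) :=
    tendsto_one_div_add_atTop_nhds_zero_nat.comp hφ.tendsto_atTop
  have hcauchy : CauchySeq (u ∘ φ) := by
    rw [cauchySeq_iff_tendsto_dist_atTop_0]
    have hd : Tendsto (fun n : ℕ × ℕ => dist (J (u (φ n.1))) (J (u (φ n.2)))) atTop (𝓝 0) :=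
      cauchySeq_iff_tendsto_dist_atTop_0.1 hlim.cauchySeq
    have ha : Tendsto (fun n : ℕ × ℕ => 1 / (((φ n.1 : ℕ) : ℝ) + 1)) atTop (𝓝 0) := by
      rw [← prod_atTop_atTop_eq]; exact hone.comp tendsto_fst
    have hb : Tendsto (fun n : ℕ × ℕ => 1 / (((φ n.2 : ℕ) : ℝ) + 1)) atTop (𝓝 0) := by
      rw [← prod_atTop_atTop_eq]; exact hone.comp tendsto_snd
    -- Bound from C‖a - b‖² ≤ 2 q(a,a) + 2 q(b,b) - q(a+b,a+b), with q(a+b,a+b) ≥ m(4 - ‖Ja - Jb‖²);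
    -- the multiples of m cancel.
    have hs : Tendsto (fun n : ℕ × ℕ => Real.sqrt ((2 * (1 / (((φ n.1 : ℕ) : ℝ) + 1))
        + 2 * (1 / (((φ n.2 : ℕ) : ℝ) + 1))
        + m * dist (J (u (φ n.1))) (J (u (φ n.2))) ^ 2) / C)) atTop (𝓝 0) := by
      have := (((ha.const_mul 2).add (hb.const_mul 2)).add ((hd.pow 2).const_mul m)).div_const C
      simpa using this.sqrt
    refine squeeze_zero (fun _ => dist_nonneg) (fun n => ?_) hs
    apply Real.le_sqrt_of_sq_le
    rw [le_div_iff₀ hC, dist_eq_norm, dist_eq_norm, Function.comp, Function.comp]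
    set a := u (φ n.1)
    set b := u (φ n.2)
    have e1 := hcoer (a - b)
    have e2 : q (a - b) (a - b) + q (a + b) (a + b) = 2 * q a a + 2 * q b b := by
      simp only [map_add, map_sub, _root_.add_apply, _root_.sub_apply]
      ring
    have e3 := hm (a + b) (Y.add_mem (huY _) (huY _))
    have e4 := parallelogram_law_with_norm ℝ (J a) (J b)
    have e5 : ‖J a‖ = 1 := hu1 _
    have e6 : ‖J b‖ = 1 := hu1 _
    have e7 : q a a ≤ _ := huq (φ n.1)
    have e8 : q b b ≤ _ := huq (φ n.2)
    rw [map_add] at e3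
    rw [e5, e6] at e4
    have e9 : ‖J a + J b‖ ^ 2 = 4 - ‖J a - J b‖ ^ 2 := by nlinarith
    rw [e9] at e3
    nlinarith
  obtain ⟨w, hw⟩ := cauchySeq_tendsto_of_complete hcauchy
  have hJw : Tendsto (fun n => ‖J (u (φ n))‖) atTop (𝓝 ‖J w‖) :=
    ((J.continuous.tendsto w).comp hw).norm
  have hw1 : ‖J w‖ = 1 := by
    simp only [hu1] at hJw
    exact tendsto_nhds_unique hJw tendsto_const_nhds |>.symm ▸ rfl
  refine ⟨w, hY.mem_of_tendsto hw (Eventually.of_forall fun n => huY _), ?_, ?_⟩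
  · rintro rfl; simp at hw1
  · have hq : Tendsto (fun n => q (u (φ n)) (u (φ n))) atTop (𝓝 (q w w)) :=
      ((show Continuous fun v => q v v by fun_prop).tendsto w).comp hw
    have := le_of_tendsto_of_tendsto hq (hone.const_add m) (Eventually.of_forall fun n => huq _)
    simpa [hw1] using this

/-- Orthogonal projection onto a closed subspace with respect to a coercive form. -/
theorem exists_form_projection [CompleteSpace V] (hcoer : IsCoercive q) {Z : Submodule ℝ V}
    (hZ : IsClosed (Z : Set V)) (v : V) : ∃ z ∈ Z, ∀ e ∈ Z, q (v - z) e = 0 := by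
  have : CompleteSpace Z := hZ.completeSpace_coe
  -- Lax–Milgram on the complete space Z represents the functional q(v, ·) by some z.
  let B : Z →L[ℝ] Z →L[ℝ] ℝ := q.bilinearComp Z.subtypeL Z.subtypeL
  have hB : IsCoercive B := by
    obtain ⟨C, hC, h⟩ := hcoer
    exact ⟨C, hC, fun u => h u⟩
  let f : Z →L[ℝ] ℝ := (q v).comp Z.subtypeL
  let z : Z := hB.continuousLinearEquivOfBilin.symm ((InnerProductSpace.toDual ℝ Z).symm f)
  refine ⟨z, z.2, fun e he => ?_⟩
  have h1 : B z ⟨e, he⟩ = f ⟨e, he⟩ := by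
    rw [← hB.continuousLinearEquivOfBilin_apply, ContinuousLinearEquiv.apply_symm_apply,
      InnerProductSpace.toDual_symm_apply]
  have h2 : q z e = q v e := h1
  rw [map_sub, _root_.sub_apply, h2, sub_self]

theorem IsFormEigenvector.pos (hcoer : IsCoercive q) {W : Submodule ℝ V} {μ : ℝ} {u : V}
    (h : IsFormEigenvector q J W μ u) : 0 < μ := by
  obtain ⟨C, hC, hc⟩ := hcoer
  have h1 := h.2.2 u h.1
  rw [real_inner_self_eq_norm_sq] at h1
  have h2 : 0 < q u u := by
    have := norm_pos_iff.2 h.2.1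
    exact lt_of_lt_of_le (by positivity) (hc u)
  rw [h1] at h2
  exact pos_of_mul_pos_left h2 (sq_nonneg _)

theorem IsFormEigenvector.inner_eq_zero (hsymm : ∀ u v, q u v = q v u) {W : Submodule ℝ V}
    {μ ν : ℝ} {u v : V} (hu : IsFormEigenvector q J W μ u) (hv : IsFormEigenvector q J W ν v)
    (hne : μ ≠ ν) : inner ℝ (J u) (J v) = (0 : ℝ) := by
  have h1 := hu.2.2 v hv.1
  have h2 := hv.2.2 u hu.1
  rw [hsymm, h1, real_inner_comm] at h2
  have : (μ - ν) * inner ℝ (J u) (J v) = 0 := by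
    rw [sub_mul, real_inner_comm, h2, sub_self]
  exact (mul_eq_zero.1 this).resolve_left (sub_ne_zero.2 hne)

/-- Coercivity makes the eigenvalue nonzero, so orthogonality for q and for J can be exchanged. -/
theorem IsFormEigenvector.form_eq_zero_iff (hcoer : IsCoercive q) {u v : V} {μ : ℝ}
    (h : IsFormEigenvector q J ⊤ μ u) : q u v = 0 ↔ inner ℝ (J u) (J v) = (0 : ℝ) := by
  rw [h.2.2 v trivial]
  simp [(h.pos hcoer).ne']

/-- Vectors orthogonal to a set of eigenvectors of the full form: an eigenvector on this subspace is
an eigenvector of the full form. -/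
theorem eigen_of_eigen_on_orthogonal [CompleteSpace V] (hsymm : ∀ u v, q u v = q v u)
    (hcoer : IsCoercive q) {s : Set V} (hs : ∀ e ∈ s, ∃ μ, IsFormEigenvector q J ⊤ μ e) {u : V}
    (hu : ∀ e ∈ s, q u e = 0) {m : ℝ}
    (h : ∀ v, (∀ e ∈ s, q v e = 0) → q u v = m * inner ℝ (J u) (J v)) (v : V) :
    q u v = m * inner ℝ (J u) (J v) := by
  -- The equation is known for v - z; on z, in the closed span of s, both sides vanish by
  -- continuity.
  obtain ⟨z, hz, hzv⟩ := exists_form_projection hcoer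
    (Submodule.isClosed_topologicalClosure (Submodule.span ℝ s)) v
  have hsub : s ⊆ (Submodule.span ℝ s).topologicalClosure :=
    Submodule.subset_span.trans (Submodule.le_topologicalClosure _)
  have h1 := h (v - z) fun e he => hzv e (hsub he)
  have hker : ∀ f : V →L[ℝ] ℝ, (∀ e ∈ s, f e = 0) → f z = 0 := by
    intro f hf
    have : (Submodule.span ℝ s).topologicalClosure ≤ (f : V →ₗ[ℝ] ℝ).ker :=
      Submodule.topologicalClosure_minimal _ (Submodule.span_le.2 fun e he => hf e he)
        f.isClosed_ker
    exact this hz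
  have h2 : q u z = 0 := hker (q u) hu
  have h3 : inner ℝ (J u) (J z) = (0 : ℝ) := hker ((innerSL ℝ (J u)).comp J) fun e he => by
    obtain ⟨μ, hμ⟩ := hs e he
    have := (hμ.form_eq_zero_iff hcoer (v := u)).1 (by rw [hsymm]; exact hu e he)
    simpa [real_inner_comm] using this
  simpa [map_sub, inner_sub_right, h2, h3] using h1

/-- The eigenspace (including `0`) of the restriction of `q` to `W` for the eigenvalue `μ`. -/
def formEigenspace (q : V →L[ℝ] V →L[ℝ] ℝ) (J : V →L[ℝ] H) (W : Submodule ℝ V) (μ : ℝ) :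
    Submodule ℝ V where
  carrier := {u | u ∈ W ∧ ∀ v ∈ W, q u v = μ * inner ℝ (J u) (J v)}
  zero_mem' := ⟨W.zero_mem, fun v _ => by simp⟩
  add_mem' := fun {a b} ha hb => ⟨W.add_mem ha.1 hb.1, fun v hv => by
    rw [map_add, map_add, _root_.add_apply, ha.2 v hv, hb.2 v hv, inner_add_left, mul_add]⟩
  smul_mem' := fun s a ha => ⟨W.smul_mem s ha.1, fun v hv => by
    rw [map_smul, map_smul, _root_.smul_apply, ha.2 v hv, real_inner_smul_left, smul_eq_mul]; ring⟩

theorem inner_eq_zero_of_mem_formEigenspace (hsymm : ∀ u v, q u v = q v u) {W : Submodule ℝ V}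
    {μ ν : ℝ} {u v : V} (hu : u ∈ formEigenspace q J W μ) (hv : v ∈ formEigenspace q J W ν)
    (hne : μ ≠ ν) : inner ℝ (J u) (J v) = (0 : ℝ) := by
  by_cases h0 : u = 0
  · simp [h0]
  by_cases h1 : v = 0
  · simp [h1]
  exact IsFormEigenvector.inner_eq_zero hsymm ⟨hu.1, h0, hu.2⟩ ⟨hv.1, h1, hv.2⟩ hne

theorem spectralSpan_le (W : Submodule ℝ V) (t : ℝ) : spectralSpan q J W t ≤ W :=
  Submodule.span_le.2 fun _ ⟨_, _, h⟩ => h.1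

/-- Grouping u into components u_μ, one per eigenvalue, makes them J-orthogonal, so q(u,u) = ∑ μ‖J
u_μ‖² with every μ ≤ t. -/
theorem form_le_of_mem_spectralSpan (hsymm : ∀ u v, q u v = q v u) {W : Submodule ℝ V} {t : ℝ}
    {u : V} (hu : u ∈ spectralSpan q J W t) : q u u ≤ t * ‖J u‖ ^ 2 := by
  have hsub : spectralSpan q J W t ≤ ⨆ μ : Set.Iic t, formEigenspace q J W μ := by
    refine Submodule.span_le.2 ?_
    rintro e ⟨μ, hμ, he⟩
    exact Submodule.mem_iSup_of_mem (⟨μ, hμ⟩ : Set.Iic t) ⟨he.1, he.2.2⟩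
  have huW := spectralSpan_le W t hu
  obtain ⟨f, hf, hfu⟩ := (Submodule.mem_iSup_iff_exists_finsupp _ _).1 (hsub hu)
  rw [Finsupp.sum] at hfu
  have hin : ∀ i ∈ f.support, inner ℝ (J (f i)) (J u) = ‖J (f i)‖ ^ 2 := by
    intro i hi
    rw [← hfu, map_sum, inner_sum, Finset.sum_eq_single_of_mem i hi, real_inner_self_eq_norm_sq]
    intro j _ hj
    exact inner_eq_zero_of_mem_formEigenspace hsymm (hf i) (hf j)
      (fun h => hj (Subtype.ext h.symm))
  have hq : q u u = ∑ i ∈ f.support, (i : ℝ) * ‖J (f i)‖ ^ 2 := by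
    conv_lhs => rw [← hsymm]
    rw [show q u u = q (∑ i ∈ f.support, f i) u by rw [hfu], map_sum, _root_.sum_apply]
    exact Finset.sum_congr rfl fun i hi => by rw [(hf i).2 u huW, hin i hi]
  have hn : ‖J u‖ ^ 2 = ∑ i ∈ f.support, ‖J (f i)‖ ^ 2 := by
    rw [← real_inner_self_eq_norm_sq,
      show inner ℝ (J u) (J u) = inner ℝ (J (∑ i ∈ f.support, f i)) (J u) by rw [hfu], map_sum,
      sum_inner]
    exact Finset.sum_congr rfl hin
  rw [hq, hn, Finset.mul_sum]
  exact Finset.sum_le_sum fun i _ => mul_le_mul_of_nonneg_right i.2 (sq_nonneg _)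

/-- The inequality passes to the closure of S. There coercivity bounds ‖u‖ by a multiple of ‖J u‖,
so the restriction of J is both compact and a closed embedding; the identity is then compact and
Riesz's theorem applies. -/
theorem finiteDimensional_of_form_le [CompleteSpace V] (hcoer : IsCoercive q)
    (hJ : IsCompactOperator J) {S : Submodule ℝ V} {t : ℝ}
    (hS : ∀ u ∈ S, q u u ≤ t * ‖J u‖ ^ 2) : FiniteDimensional ℝ S := by
  obtain ⟨C, hC, hcoer⟩ := hcoer
  set Z := S.topologicalClosure
  have hZ : ∀ u ∈ Z, q u u ≤ t * ‖J u‖ ^ 2 := fun u hu => by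
    have hcl : IsClosed {u | q u u ≤ t * ‖J u‖ ^ 2} :=
      isClosed_le (by fun_prop) (by fun_prop)
    exact closure_minimal hS hcl hu
  have : CompleteSpace Z := S.isClosed_topologicalClosure.completeSpace_coe
  let T : Z →L[ℝ] H := J.comp Z.subtypeL
  have hT : IsCompactOperator T := hJ.comp_clm Z.subtypeL
  have hanti : AntilipschitzWith (Real.sqrt (|t| / C)).toNNReal T := by
    refine T.antilipschitz_of_bound fun u => ?_
    rw [Real.coe_toNNReal _ (Real.sqrt_nonneg _)]
    have h1 : C * ‖(u : V)‖ * ‖(u : V)‖ ≤ q u u := hcoer u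
    have h2 : q (u : V) u ≤ t * ‖T u‖ ^ 2 := hZ u u.2
    have h3 : t * ‖T u‖ ^ 2 ≤ |t| * ‖T u‖ ^ 2 :=
      mul_le_mul_of_nonneg_right (le_abs_self t) (sq_nonneg _)
    refine abs_le_of_sq_le_sq' ?_ (by positivity) |>.2
    rw [mul_pow, Real.sq_sqrt (by positivity), div_mul_eq_mul_div, le_div_iff₀ hC,
      Submodule.coe_norm]
    nlinarith
  have hemb := hanti.isClosedEmbedding T.uniformContinuous
  have hid : IsCompactOperator (id : Z → Z) := by
    obtain ⟨K, hK, hK0⟩ := hT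
    exact ⟨T ⁻¹' K, hemb.isCompact_preimage hK, hK0⟩
  have : FiniteDimensional ℝ Z := FiniteDimensional.of_isCompactOperator_id (𝕜 := ℝ) hid
  exact Submodule.finiteDimensional_of_le S.le_topologicalClosure

theorem finiteDimensional_spectralSpan [CompleteSpace V] (hsymm : ∀ u v, q u v = q v u)
    (hcoer : IsCoercive q) (hJ : IsCompactOperator J) (W : Submodule ℝ V) (t : ℝ) :
    FiniteDimensional ℝ (spectralSpan q J W t) :=
  finiteDimensional_of_form_le hcoer hJ fun _ => form_le_of_mem_spectralSpan hsymm

/-- One eigenvector per eigenvalue gives a J-orthogonal, hence independent, family in a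
finite-dimensional spectral space. -/
theorem finite_eigenvalues_le [CompleteSpace V] (hsymm : ∀ u v, q u v = q v u)
    (hcoer : IsCoercive q) (hJ : IsCompactOperator J) (hinj : Function.Injective J)
    (W : Submodule ℝ V) (t : ℝ) : {μ | μ ≤ t ∧ ∃ u, IsFormEigenvector q J W μ u}.Finite := by
  have := finiteDimensional_spectralSpan hsymm hcoer hJ W t
  set A := {μ | μ ≤ t ∧ ∃ u, IsFormEigenvector q J W μ u}
  have hA : ∀ μ : A, ∃ u, IsFormEigenvector q J W μ u := fun μ => μ.2.2
  choose e he using hA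
  let e' : A → spectralSpan q J W t := fun μ =>
    ⟨e μ, Submodule.subset_span ⟨μ, μ.2.1, he μ⟩⟩
  have hli : LinearIndependent ℝ e' := by
    refine LinearIndependent.of_comp ((J : V →ₗ[ℝ] H) ∘ₗ (spectralSpan q J W t).subtype)
      (linearIndependent_of_ne_zero_of_inner_eq_zero (𝕜 := ℝ) (fun μ h => ?_) fun μ ν hne => ?_)
    · exact (he μ).2.1 (hinj (by rw [map_zero]; exact h))
    · exact (he μ).inner_eq_zero hsymm (he ν) fun h => hne (Subtype.ext h)
  exact Set.finite_coe_iff.1 hli.finite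

/-- The orthogonal complement of `s` with respect to the form `q`. -/
def formOrthogonal (q : V →L[ℝ] V →L[ℝ] ℝ) (s : Set V) : Submodule ℝ V where
  carrier := {u | ∀ e ∈ s, q u e = 0}
  zero_mem' := fun e _ => by simp
  add_mem' := fun {a b} ha hb e he => by rw [map_add, _root_.add_apply, ha e he, hb e he, add_zero]
  smul_mem' := fun t a ha e he => by rw [map_smul, _root_.smul_apply, ha e he, smul_zero]

theorem isClosed_formOrthogonal (s : Set V) : IsClosed (formOrthogonal q s : Set V) := by
  have : (formOrthogonal q s : Set V) = ⋂ e ∈ s, {u | q u e = 0} := by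
    ext u; simp [formOrthogonal]
  rw [this]
  exact isClosed_biInter fun e _ => isClosed_eq (by fun_prop) continuous_const

/-- A minimizer on the complement satisfies the eigenvalue equation there; since s consists of
eigenvectors, the equation extends to all of V. -/
theorem exists_least_eigenvector_formOrthogonal [CompleteSpace V] (hsymm : ∀ u v, q u v = q v u)
    (hcoer : IsCoercive q) (hJ : IsCompactOperator J) (hinj : Function.Injective J)
    {s : Set V} (hs : ∀ e ∈ s, ∃ μ, IsFormEigenvector q J ⊤ μ e) (hne : formOrthogonal q s ≠ ⊥) :
    ∃ m, ∃ u ∈ formOrthogonal q s, IsFormEigenvector q J ⊤ m u ∧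
      ∀ y ∈ formOrthogonal q s, m * ‖J y‖ ^ 2 ≤ q y y := by
  obtain ⟨m, hm, u, hu, hu0, hule⟩ :=
    exists_form_minimizer hcoer hJ hinj (isClosed_formOrthogonal s) hne
  exact ⟨m, u, hu, ⟨trivial, hu0, fun v _ => eigen_of_eigen_on_orthogonal hsymm hcoer hs hu
    (fun v hv => form_eq_of_minimizer hsymm hm hu hule v hv) v⟩, hm⟩

/-- Completeness of the eigenvectors: a nonzero complement of all of them would contain an
eigenvector, which would be orthogonal to itself. -/
theorem eq_top_of_eigenvectors_mem [CompleteSpace V] (hsymm : ∀ u v, q u v = q v u)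
    (hcoer : IsCoercive q) (hJ : IsCompactOperator J) (hinj : Function.Injective J)
    {W : Submodule ℝ V} (hW : IsClosed (W : Set V))
    (h : ∀ μ u, IsFormEigenvector q J ⊤ μ u → u ∈ W) : W = ⊤ := by
  set s : Set V := {u | ∃ μ, IsFormEigenvector q J ⊤ μ u}
  have hs : (Submodule.span ℝ s).topologicalClosure ≤ W :=
    Submodule.topologicalClosure_minimal _ (Submodule.span_le.2 fun u ⟨μ, hu⟩ => h μ u hu) hW
  have hbot : formOrthogonal q s = ⊥ := by
    by_contra hne
    obtain ⟨m, u, hu, heig, -⟩ :=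
      exists_least_eigenvector_formOrthogonal hsymm hcoer hJ hinj (fun e he => he) hne
    have h0 : q u u = 0 := hu u ⟨m, heig⟩
    rw [heig.form_eq_zero_iff hcoer, inner_self_eq_zero] at h0
    exact heig.2.1 (hinj (by rw [h0, map_zero]))
  refine Submodule.eq_top_iff'.2 fun v => hs ?_
  obtain ⟨z, hz, hzv⟩ := exists_form_projection hcoer
    (Submodule.isClosed_topologicalClosure (Submodule.span ℝ s)) v
  have hmem : v - z ∈ formOrthogonal q s := fun e he =>
    hzv e (Submodule.le_topologicalClosure _ (Submodule.subset_span he))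
  rw [hbot, Submodule.mem_bot, sub_eq_zero] at hmem
  rwa [hmem]

/-- Project u onto the span of the eigenvectors below t. That span lies in both spectral spaces, so
the remainder keeps Rayleigh quotient at most t; on the complement the least value is at least t, so
the remainder is zero or a minimizer, hence an eigenvector. -/
theorem spectralSpan_le_of_eigenvectors_mem [CompleteSpace V] (hsymm : ∀ u v, q u v = q v u)
    (hcoer : IsCoercive q) (hJ : IsCompactOperator J) (hinj : Function.Injective J)
    {W : Submodule ℝ V} {t : ℝ} (h : ∀ μ < t, ∀ u, IsFormEigenvector q J ⊤ μ u → u ∈ W) :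
    spectralSpan q J W t ≤ spectralSpan q J ⊤ t := by
  intro u hu
  set s : Set V := {e | ∃ μ < t, IsFormEigenvector q J ⊤ μ e}
  have hs : ∀ e ∈ s, ∃ μ, IsFormEigenvector q J ⊤ μ e := fun e ⟨μ, _, he⟩ => ⟨μ, he⟩
  have hsT : Submodule.span ℝ s ≤ spectralSpan q J ⊤ t :=
    Submodule.span_mono fun e ⟨μ, hμ, he⟩ => ⟨μ, hμ.le, he⟩
  have hsW : Submodule.span ℝ s ≤ spectralSpan q J W t :=
    Submodule.span_mono fun e ⟨μ, hμ, he⟩ =>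
      ⟨μ, hμ.le, h μ hμ e he, he.2.1, fun v _ => he.2.2 v trivial⟩
  have := finiteDimensional_spectralSpan hsymm hcoer hJ ⊤ t
  have : FiniteDimensional ℝ (Submodule.span ℝ s) := Submodule.finiteDimensional_of_le hsT
  obtain ⟨z, hz, hzv⟩ := exists_form_projection hcoer
    (Submodule.closed_of_finiteDimensional (Submodule.span ℝ s)) u
  have hyY : u - z ∈ formOrthogonal q s := fun e he => hzv e (Submodule.subset_span he)
  have hle := form_le_of_mem_spectralSpan hsymm ((spectralSpan q J W t).sub_mem hu (hsW hz))
  suffices hy : u - z ∈ spectralSpan q J ⊤ t by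
    simpa using (spectralSpan q J ⊤ t).add_mem hy (hsT hz)
  by_cases hy0 : u - z = 0
  · rw [hy0]; exact Submodule.zero_mem _
  have hne : formOrthogonal q s ≠ ⊥ := fun hb => hy0 (by rwa [hb, Submodule.mem_bot] at hyY)
  obtain ⟨m, w, hw, heig, hmin⟩ :=
    exists_least_eigenvector_formOrthogonal hsymm hcoer hJ hinj hs hne
  -- If m < t, the eigenvector w would belong to s and be orthogonal to itself.
  have hmt : t ≤ m := by
    by_contra hlt
    have h0 : q w w = 0 := hw w ⟨m, not_le.1 hlt, heig⟩
    rw [heig.form_eq_zero_iff hcoer, inner_self_eq_zero] at h0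
    exact heig.2.1 (hinj (by rw [h0, map_zero]))
  have hle' : q (u - z) (u - z) ≤ m * ‖J (u - z)‖ ^ 2 :=
    hle.trans (mul_le_mul_of_nonneg_right hmt (sq_nonneg _))
  have hpos : 0 < ‖J (u - z)‖ ^ 2 := by
    have : J (u - z) ≠ 0 := fun h0 => hy0 (hinj (by rw [h0, map_zero]))
    positivity
  have hmt' : m ≤ t := le_of_mul_le_mul_right ((hmin _ hyY).trans hle) hpos
  exact Submodule.subset_span ⟨m, hmt', trivial, hy0, fun v _ =>
    eigen_of_eigen_on_orthogonal hsymm hcoer hs hyY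
      (fun v hv => form_eq_of_minimizer hsymm hmin hyY hle' v hv) v⟩

/-- If the restriction of `q` to a closed subspace has the same eigenvalues as `q`, then this
subspace is the whole space. -/
theorem eq_top_of_formEigenvalue_eq [CompleteSpace V] (hsymm : ∀ u v, q u v = q v u)
    (hcoer : IsCoercive q) (hJ : IsCompactOperator J) (hinj : Function.Injective J)
    {W : Submodule ℝ V} (hW : IsClosed (W : Set V))
    (h : ∀ n : ℕ, 1 ≤ n → formEigenvalue q J W n = formEigenvalue q J ⊤ n) : W = ⊤ := by
  by_contra hne
  have hex : ∃ μ u, IsFormEigenvector q J ⊤ μ u ∧ u ∉ W := by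
    by_contra hcon
    push Not at hcon
    exact hne (eq_top_of_eigenvectors_mem hsymm hcoer hJ hinj hW hcon)
  obtain ⟨μ₀, u₀, hu₀, hu₀W⟩ := hex
  -- A least eigenvalue with an eigenvector outside W exists because only finitely many eigenvalues
  -- lie below μ₀.
  obtain ⟨l, ⟨-, f, hf, hfW⟩, hmin⟩ : ∃ l ∈ {μ | μ ≤ μ₀ ∧ ∃ u, IsFormEigenvector q J ⊤ μ u ∧ u ∉ W},
      ∀ μ ∈ {μ | μ ≤ μ₀ ∧ ∃ u, IsFormEigenvector q J ⊤ μ u ∧ u ∉ W}, l ≤ μ := by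
    refine Set.exists_min_image _ id ((finite_eigenvalues_le hsymm hcoer hJ hinj ⊤ μ₀).subset ?_)
      ⟨μ₀, le_rfl, u₀, hu₀, hu₀W⟩
    rintro μ ⟨h1, u, h2, -⟩
    exact ⟨h1, u, h2⟩
  have hlow : ∀ μ < l, ∀ u, IsFormEigenvector q J ⊤ μ u → u ∈ W := by
    intro μ hμ u hu
    by_contra huW
    by_cases hμ₀ : μ ≤ μ₀
    · exact absurd (hmin μ ⟨hμ₀, u, hu, huW⟩) (not_le.2 hμ)
    · have := hmin μ₀ ⟨le_rfl, u₀, hu₀, hu₀W⟩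
      linarith
  have hle := spectralSpan_le_of_eigenvectors_mem hsymm hcoer hJ hinj hlow
  have hfmem : f ∈ spectralSpan q J ⊤ l := Submodule.subset_span ⟨l, le_rfl, hf⟩
  have hlt : spectralSpan q J W l < spectralSpan q J ⊤ l :=
    lt_of_le_of_ne hle fun heq => hfW (spectralSpan_le W l (heq ▸ hfmem))
  have hfd := finiteDimensional_spectralSpan hsymm hcoer hJ ⊤ l
  have hfdW := finiteDimensional_spectralSpan hsymm hcoer hJ W l
  have hrank := Submodule.finrank_lt_finrank_of_lt hlt
  set n := Module.finrank ℝ (spectralSpan q J ⊤ l) with hn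
  have htop : formEigenvalue q J ⊤ n ≤ (l : EReal) := by
    have : Module.Finite ℝ (Submodule.span ℝ {u | ∃ μ ≤ l, IsFormEigenvector q J ⊤ μ u}) := hfd
    obtain ⟨e, he, -, hli⟩ := Submodule.exists_fun_fin_finrank_span_eq ℝ
      {u | ∃ μ ≤ l, IsFormEigenvector q J ⊤ μ u}
    exact sInf_le ⟨l, ⟨e, hli, he⟩, rfl⟩
  -- Finiteness of the eigenvalues on W up to l + 1 leaves a gap (l, t). It makes the n-th
  -- eigenvalue on W at least t, hence strictly above l.
  obtain ⟨t, hlt', hgap⟩ : ∃ t > l, ∀ μ u, IsFormEigenvector q J W μ u → μ < t → μ ≤ l := by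
    have hfin : ({μ | μ ≤ l + 1 ∧ ∃ u, IsFormEigenvector q J W μ u} ∩ Set.Ioi l).Finite :=
      (finite_eigenvalues_le hsymm hcoer hJ hinj W (l + 1)).inter_of_left _
    have hopen : IsOpen ({μ | μ ≤ l + 1 ∧ ∃ u, IsFormEigenvector q J W μ u} ∩ Set.Ioi l)ᶜ :=
      hfin.isClosed.isOpen_compl
    obtain ⟨ε, hε, hball⟩ := Metric.isOpen_iff.1 hopen l (fun h => lt_irrefl l (Set.mem_Ioi.1 h.2))
    refine ⟨l + min ε 1, by simp [hε], fun μ u hu hμ => ?_⟩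
    by_contra hgt
    rw [not_le] at hgt
    have h1 := min_le_left ε 1
    have h2 := min_le_right ε 1
    refine hball (show μ ∈ Metric.ball l ε from ?_) ⟨⟨by linarith, u, hu⟩, hgt⟩
    rw [Metric.mem_ball, Real.dist_eq, abs_lt]
    constructor <;> linarith
  -- With r < t, the gap would place n independent vectors in the spectral space of W up to l, whose
  -- dimension is below n.
  have hbig : (t : EReal) ≤ formEigenvalue q J W n := by
    refine le_sInf ?_
    rintro _ ⟨r, ⟨e, hli, he⟩, rfl⟩
    by_contra hrt
    have hrt' : r < t := EReal.coe_lt_coe_iff.1 (not_le.1 hrt)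
    have hmem : ∀ i, e i ∈ spectralSpan q J W l := fun i => by
      obtain ⟨μ, hμ, hei⟩ := he i
      exact Submodule.subset_span ⟨μ, hgap μ _ hei (hμ.trans_lt hrt'), hei⟩
    have hli' : LinearIndependent ℝ (fun i => (⟨e i, hmem i⟩ : spectralSpan q J W l)) :=
      LinearIndependent.of_comp (spectralSpan q J W l).subtype hli
    have := hli'.fintype_card_le_finrank
    rw [Fintype.card_fin] at this
    omega
  have hcontra : (t : EReal) ≤ l := by
    have h1 := h n (by omega)
    exact hbig.trans (h1.le.trans htop)
  exact absurd (EReal.coe_le_coe_iff.1 hcontra) (not_le.2 hlt')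

end AbstractSpectral

/-! ### H¹(Ω) as a Hilbert space and multiplication by smooth functions -/

variable {N : ℕ} {Ω : Set (Eucl N)}

theorem H1.norm_sq (u : H1 Ω) : ‖u‖ ^ 2 = ‖H1.val u‖ ^ 2 + ‖H1.grad u‖ ^ 2 :=
  WithLp.prod_norm_sq_eq_of_L2 (u : WithLp 2 (L2 Ω × L2Vec Ω))

/-- `H1.val` as a continuous linear map. -/
def H1.valL (Ω : Set (Eucl N)) : H1 Ω →L[ℝ] L2 Ω :=
  (WithLp.fstL 2 ℝ (L2 Ω) (L2Vec Ω)).comp (H1 Ω).subtypeL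

/-- `H1.grad` as a continuous linear map. -/
def H1.gradL (Ω : Set (Eucl N)) : H1 Ω →L[ℝ] L2Vec Ω :=
  (WithLp.sndL 2 ℝ (L2 Ω) (L2Vec Ω)).comp (H1 Ω).subtypeL

@[simp] theorem H1.valL_apply (u : H1 Ω) : H1.valL Ω u = H1.val u := rfl

/-- The element of `H¹(Ω)` with given value and weak gradient. -/
def H1.mk (u : L2 Ω) (g : L2Vec Ω) (h : IsWeakGradient Ω u g) : H1 Ω := ⟨WithLp.toLp 2 (u, g), h⟩

theorem H1.isWeakGradient (u : H1 Ω) : IsWeakGradient Ω (H1.val u) (H1.grad u) := u.2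

theorem IsTestFunction.mono {Ω' : Set (Eucl N)} {φ : Eucl N → ℝ} (h : IsTestFunction Ω φ)
    (hsub : Ω ⊆ Ω') : IsTestFunction Ω' φ := ⟨h.smooth, h.compact, h.supp.trans hsub⟩

theorem IsTestFunction.eq_zero {φ : Eucl N → ℝ} (h : IsTestFunction Ω φ) {x : Eucl N}
    (hx : x ∉ Ω) : φ x = 0 := image_eq_zero_of_notMem_tsupport fun hx' => hx (h.supp hx')

theorem IsTestFunction.fderiv_eq_zero {φ : Eucl N → ℝ} (h : IsTestFunction Ω φ) {x : Eucl N}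
    (hx : x ∉ Ω) : fderiv ℝ φ x = 0 :=
  image_eq_zero_of_notMem_tsupport fun hx' => hx (h.supp (tsupport_fderiv_subset ℝ hx'))

theorem IsTestFunction.mul {Ω' : Set (Eucl N)} {χ φ : Eucl N → ℝ} (hχ : IsTestFunction Ω' χ)
    (h : IsTestFunction Ω φ) : IsTestFunction Ω (fun x => χ x * φ x) :=
  ⟨hχ.smooth.mul h.smooth, h.compact.mul_left, (tsupport_mul_subset_right).trans h.supp⟩

theorem IsTestFunction.add {χ φ : Eucl N → ℝ} (hχ : IsTestFunction Ω χ)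
    (h : IsTestFunction Ω φ) : IsTestFunction Ω (fun x => χ x + φ x) :=
  ⟨hχ.smooth.add h.smooth, hχ.compact.add h.compact,
    (tsupport_add χ φ).trans (Set.union_subset hχ.supp h.supp)⟩

theorem IsTestFunction.sub {χ φ : Eucl N → ℝ} (hχ : IsTestFunction Ω χ)
    (h : IsTestFunction Ω φ) : IsTestFunction Ω (fun x => χ x - φ x) :=
  ⟨hχ.smooth.sub h.smooth, hχ.compact.sub h.compact,
    (tsupport_sub χ φ).trans (Set.union_subset hχ.supp h.supp)⟩

theorem IsTestFunction.continuous_gradient {φ : Eucl N → ℝ} (h : IsTestFunction Ω φ) :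
    Continuous (gradient φ) := by
  have := h.smooth.continuous_fderiv (by simp)
  exact (InnerProductSpace.toDual ℝ (Eucl N)).symm.continuous.comp this

theorem IsTestFunction.compact_gradient {φ : Eucl N → ℝ} (h : IsTestFunction Ω φ) :
    HasCompactSupport (gradient φ) :=
  (h.compact.fderiv (𝕜 := ℝ)).comp_left (g := (InnerProductSpace.toDual ℝ (Eucl N)).symm)
    (map_zero _)

theorem IsTestFunction.memLp_gradient {φ : Eucl N → ℝ} (h : IsTestFunction Ω φ)
    (p : ENNReal) (Ω' : Set (Eucl N)) : MemLp (gradient φ) p (volume.restrict Ω') :=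
  (h.continuous_gradient.memLp_of_hasCompactSupport h.compact_gradient).restrict Ω'

theorem IsTestFunction.memLp_restrict {φ : Eucl N → ℝ} (h : IsTestFunction Ω φ)
    (p : ENNReal) (Ω' : Set (Eucl N)) : MemLp φ p (volume.restrict Ω') :=
  (h.smooth.continuous.memLp_of_hasCompactSupport h.compact).restrict Ω'

/-- For a fixed test function both sides of the weak gradient identity are L² inner products with
fixed elements, so the identity survives limits. -/
theorem isClosed_H1 (Ω : Set (Eucl N)) : IsClosed (H1 Ω : Set (WithLp 2 (L2 Ω × L2Vec Ω))) := by
  have : (H1 Ω : Set (WithLp 2 (L2 Ω × L2Vec Ω))) =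
      ⋂ (φ : Eucl N → ℝ) (_ : IsTestFunction Ω φ) (v : Eucl N), {p |
        ∫ x in Ω, p.fst x * fderiv ℝ φ x v = -∫ x in Ω, inner ℝ (p.snd x) v * φ x} := by
    ext p; simp [H1, IsWeakGradient]
  rw [this]
  refine isClosed_iInter fun φ => isClosed_iInter fun hφ => isClosed_iInter fun v => ?_
  have h1 : ∀ u : L2 Ω, ∫ x in Ω, u x * fderiv ℝ φ x v
      = inner ℝ ((hφ.memLp_fderiv v).toLp _) u := by
    intro u
    rw [L2.inner_def]
    refine integral_congr_ae ?_
    filter_upwards [(hφ.memLp_fderiv v).coeFn_toLp] with x hx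
    rw [hx]; simp
  have hm : MemLp (fun x => φ x • v) 2 (volume.restrict Ω) :=
    (hφ.smooth.continuous.smul continuous_const).memLp_of_hasCompactSupport
      (hφ.compact.smul_right) |>.restrict Ω
  have h2 : ∀ g : L2Vec Ω, ∫ x in Ω, inner ℝ (g x) v * φ x = inner ℝ g (hm.toLp _) := by
    intro g
    rw [L2.inner_def]
    refine integral_congr_ae ?_
    filter_upwards [hm.coeFn_toLp] with x hx
    rw [hx, real_inner_smul_right, mul_comm]
  simp_rw [h1, h2]
  have c1 : Continuous (fun p : WithLp 2 (L2 Ω × L2Vec Ω) => p.fst) :=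
    (WithLp.fstL 2 ℝ (L2 Ω) (L2Vec Ω)).continuous
  have c2 : Continuous (fun p : WithLp 2 (L2 Ω × L2Vec Ω) => p.snd) :=
    (WithLp.sndL 2 ℝ (L2 Ω) (L2Vec Ω)).continuous
  exact isClosed_eq (continuous_const.inner c1) (c2.inner continuous_const).neg

instance : CompleteSpace (H1 Ω) := (isClosed_H1 Ω).completeSpace_coe

/-- The weak gradient is determined by the function. -/
theorem H1.val_injective (hopen : IsOpen Ω) : Function.Injective (H1.val (Ω := Ω)) := by
  suffices h : ∀ u : H1 Ω, H1.val u = 0 → u = 0 by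
    intro u w huw
    refine sub_eq_zero.1 (h _ ?_)
    rw [← H1.valL_apply, map_sub, H1.valL_apply, H1.valL_apply, huw, sub_self]
  intro u hu
  have hg : H1.grad u = 0 := by
    have hloc : LocallyIntegrableOn (H1.grad u) Ω volume := by
      have : LocallyIntegrable (H1.grad u) (volume.restrict Ω) :=
        (Lp.memLp (H1.grad u)).locallyIntegrable (by norm_num)
      exact locallyIntegrableOn_of_locallyIntegrable_restrict this
    -- Fundamental lemma of the calculus of variations: when u = 0, the weak gradient integrates to
    -- zero against every test function.
    have hz := hopen.ae_eq_zero_of_integral_contDiff_smul_eq_zero hloc fun φ h1 h2 h3 => ?_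
    · rw [Lp.eq_zero_iff_ae_eq_zero]
      exact (ae_restrict_iff' hopen.measurableSet).2 hz
    · have hφ : IsTestFunction Ω φ := ⟨h1, h2, h3⟩
      have hint : Integrable (fun x => φ x • H1.grad u x) (volume.restrict Ω) :=
        memLp_one_iff_integrable.1 ((Lp.memLp (H1.grad u)).smul hφ.memLp)
      rw [← setIntegral_eq_integral_of_forall_compl_eq_zero (s := Ω)
        (fun x hx => by rw [hφ.eq_zero hx, zero_smul])]
      refine ext_inner_right ℝ fun v => ?_
      rw [inner_zero_left, real_inner_comm, ← integral_inner hint]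
      have h := H1.isWeakGradient u φ hφ v
      have h0 : ∫ x in Ω, H1.val u x * fderiv ℝ φ x v = 0 := by
        rw [hu]
        refine integral_eq_zero_of_ae ?_
        filter_upwards [Lp.coeFn_zero ℝ 2 (volume.restrict Ω)] with x hx
        rw [hx]; simp
      rw [h0, eq_comm, neg_eq_zero] at h
      rw [← h]
      refine integral_congr_ae (Eventually.of_forall fun x => ?_)
      simp only [real_inner_smul_right, real_inner_comm, mul_comm]
  have hn := H1.norm_sq u
  rw [hu, hg, norm_zero, norm_zero] at hn
  exact norm_eq_zero.1 (by nlinarith)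

/-- The test function vanishes outside Ω, so the integrals extend to the whole space and no boundary
term appears. -/
theorem isWeakGradient_of_smooth (Ω : Set (Eucl N)) {φ : Eucl N → ℝ}
    (hφ : IsTestFunction Set.univ φ) :
    IsWeakGradient Ω ((hφ.memLp_restrict 2 Ω).toLp φ)
      ((hφ.memLp_gradient 2 Ω).toLp (gradient φ)) := by
  intro η hη v
  have h1 : ∫ x in Ω, ((hφ.memLp_restrict 2 Ω).toLp φ) x * fderiv ℝ η x v
      = ∫ x, φ x * fderiv ℝ η x v := by
    refine Eq.trans ?_ (setIntegral_eq_integral_of_forall_compl_eq_zero (s := Ω)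
      (f := fun x => φ x * fderiv ℝ η x v) (fun x hx => by rw [hη.fderiv_eq_zero hx]; simp))
    refine integral_congr_ae ?_
    filter_upwards [(hφ.memLp_restrict 2 Ω).coeFn_toLp] with x hx
    rw [hx]
  have h2 : ∫ x in Ω, inner ℝ (((hφ.memLp_gradient 2 Ω).toLp (gradient φ)) x) v * η x
      = ∫ x, fderiv ℝ φ x v * η x := by
    refine Eq.trans ?_ (setIntegral_eq_integral_of_forall_compl_eq_zero (s := Ω)
      (f := fun x => fderiv ℝ φ x v * η x) (fun x hx => by rw [hη.eq_zero hx]; simp))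
    refine integral_congr_ae ?_
    filter_upwards [(hφ.memLp_gradient 2 Ω).coeFn_toLp] with x hx
    rw [hx, inner_gradient_left]
  have hd : ∀ {ψ : Eucl N → ℝ}, ContDiff ℝ ∞ ψ → Continuous (fun x => fderiv ℝ ψ x v) :=
    fun h => (h.continuous_fderiv (by simp)).clm_apply continuous_const
  rw [h1, h2]
  refine integral_mul_fderiv_eq_neg_fderiv_mul_of_integrable ?_ ?_ ?_ ?_ ?_
  · exact ((hd hφ.smooth).mul hη.smooth.continuous).integrable_of_hasCompactSupport
      hη.compact.mul_left
  · exact (hφ.smooth.continuous.mul (hd hη.smooth)).integrable_of_hasCompactSupport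
      hφ.compact.mul_right
  · exact (hφ.smooth.continuous.mul hη.smooth.continuous).integrable_of_hasCompactSupport
      hη.compact.mul_left
  · exact fun x _ => hφ.smooth.differentiable (by simp) x
  · exact fun x _ => hη.smooth.differentiable (by simp) x

/-- The restriction to `Ω` of a smooth compactly supported function, as an element of `H¹(Ω)`. -/
def ofSmooth (Ω : Set (Eucl N)) (φ : Eucl N → ℝ) (hφ : IsTestFunction Set.univ φ) : H1 Ω :=
  H1.mk _ _ (isWeakGradient_of_smooth Ω hφ)

theorem val_ofSmooth {φ : Eucl N → ℝ} (hφ : IsTestFunction Set.univ φ) :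
    H1.val (ofSmooth Ω φ hφ) =ᵐ[volume.restrict Ω] φ := (hφ.memLp_restrict 2 Ω).coeFn_toLp

theorem grad_ofSmooth {φ : Eucl N → ℝ} (hφ : IsTestFunction Set.univ φ) :
    H1.grad (ofSmooth Ω φ hφ) =ᵐ[volume.restrict Ω] gradient φ :=
  (hφ.memLp_gradient 2 Ω).coeFn_toLp

theorem gradient_mul {φ ψ : Eucl N → ℝ} {x : Eucl N} (hφ : DifferentiableAt ℝ φ x)
    (hψ : DifferentiableAt ℝ ψ x) :
    gradient (fun y => φ y * ψ y) x = φ x • gradient ψ x + ψ x • gradient φ x := by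
  refine ext_inner_right ℝ fun v => ?_
  rw [inner_gradient_left, fderiv_fun_mul hφ hψ, inner_add_left, real_inner_smul_left,
    real_inner_smul_left, inner_gradient_left, inner_gradient_left]
  simp

/-- Multiplication of `H¹(Ω)` by a smooth compactly supported function, as a map into the ambient
Hilbert sum. -/
def mulSmoothAux (Ω : Set (Eucl N)) (χ : Eucl N → ℝ) (hχ : IsTestFunction Set.univ χ) :
    H1 Ω →L[ℝ] WithLp 2 (L2 Ω × L2Vec Ω) :=
  ((WithLp.prodContinuousLinearEquiv 2 ℝ (L2 Ω) (L2Vec Ω)).symm :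
    (L2 Ω × L2Vec Ω) →L[ℝ] WithLp 2 (L2 Ω × L2Vec Ω)).comp
  ((((ContinuousLinearMap.lsmul ℝ ℝ).holderL (volume.restrict Ω) ⊤ 2 2
      ((hχ.memLp_restrict ⊤ Ω).toLp χ)).comp (H1.valL Ω)).prod
    (((ContinuousLinearMap.lsmul ℝ ℝ).holderL (volume.restrict Ω) ⊤ 2 2
      ((hχ.memLp_restrict ⊤ Ω).toLp χ)).comp (H1.gradL Ω) +
     ((ContinuousLinearMap.lsmul ℝ ℝ).flip.holderL (volume.restrict Ω) ⊤ 2 2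
      ((hχ.memLp_gradient ⊤ Ω).toLp (gradient χ))).comp (H1.valL Ω)))

theorem fst_mulSmoothAux {χ : Eucl N → ℝ} (hχ : IsTestFunction Set.univ χ) (u : H1 Ω) :
    (mulSmoothAux Ω χ hχ u).fst =ᵐ[volume.restrict Ω] fun x => χ x * H1.val u x := by
  have h1 := (ContinuousLinearMap.lsmul ℝ ℝ).coeFn_holder (r := 2)
    ((hχ.memLp_restrict ⊤ Ω).toLp χ) (H1.val u)
  filter_upwards [h1, (hχ.memLp_restrict ⊤ Ω).coeFn_toLp] with x h1 h2
  refine h1.trans ?_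
  rw [h2]; rfl

theorem snd_mulSmoothAux {χ : Eucl N → ℝ} (hχ : IsTestFunction Set.univ χ) (u : H1 Ω) :
    (mulSmoothAux Ω χ hχ u).snd =ᵐ[volume.restrict Ω]
      fun x => χ x • H1.grad u x + H1.val u x • gradient χ x := by
  have h1 := (ContinuousLinearMap.lsmul ℝ ℝ).coeFn_holder (r := 2)
    ((hχ.memLp_restrict ⊤ Ω).toLp χ) (H1.grad u)
  have h2 := (ContinuousLinearMap.lsmul ℝ ℝ).flip.coeFn_holder (r := 2)
    ((hχ.memLp_gradient ⊤ Ω).toLp (gradient χ)) (H1.val u)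
  have h3 := Lp.coeFn_add (ContinuousLinearMap.holder 2 (ContinuousLinearMap.lsmul ℝ ℝ)
      ((hχ.memLp_restrict ⊤ Ω).toLp χ) (H1.grad u))
    (ContinuousLinearMap.holder 2 (ContinuousLinearMap.lsmul ℝ ℝ).flip
      ((hχ.memLp_gradient ⊤ Ω).toLp (gradient χ)) (H1.val u))
  filter_upwards [h1, h2, h3, (hχ.memLp_restrict ⊤ Ω).coeFn_toLp,
    (hχ.memLp_gradient ⊤ Ω).coeFn_toLp] with x h1 h2 h3 h4 h5
  refine h3.trans ?_
  rw [Pi.add_apply, h1, h2, h4, h5]; rfl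

/-- Product rule for weak gradients: χφ is used as a test function for u. -/
theorem mulSmoothAux_mem {χ : Eucl N → ℝ} (hχ : IsTestFunction Set.univ χ) (u : H1 Ω) :
    mulSmoothAux Ω χ hχ u ∈ H1 Ω := by
  intro φ hφ v
  have hχφ := hχ.mul hφ
  have h := H1.isWeakGradient u _ hχφ v
  have hu := Lp.memLp (H1.val u)
  have hg := Lp.memLp (H1.grad u)
  have hd : ∀ x, fderiv ℝ (fun x => χ x * φ x) x v
      = χ x * fderiv ℝ φ x v + fderiv ℝ χ x v * φ x := fun x => by
    rw [fderiv_fun_mul (hχ.smooth.differentiable (by simp) x) (hφ.smooth.differentiable (by simp) x)]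
    simp [mul_comm]
  have i1 : Integrable (fun x => H1.val u x * (χ x * fderiv ℝ φ x v)) (volume.restrict Ω) :=
    hu.integrable_mul (q := 2) ((hφ.memLp_fderiv v).mul (hχ.memLp_restrict ⊤ Ω))
  have i2 : Integrable (fun x => H1.val u x * (fderiv ℝ χ x v * φ x)) (volume.restrict Ω) := by
    have hc : MemLp (fun x => fderiv ℝ χ x v) ⊤ (volume.restrict Ω) := by
      have := (hχ.memLp_gradient ⊤ Ω).inner_const (𝕜 := ℝ) v
      simpa only [inner_gradient_left] using this
    exact hu.integrable_mul (q := 2) (hφ.memLp.mul hc)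
  have i3 : Integrable (fun x => inner ℝ (H1.grad u x) v * (χ x * φ x)) (volume.restrict Ω) :=
    hχφ.integrable_right _ v
  have e1 : ∫ x in Ω, (mulSmoothAux Ω χ hχ u).fst x * fderiv ℝ φ x v
      = ∫ x in Ω, H1.val u x * (χ x * fderiv ℝ φ x v) := by
    refine integral_congr_ae ?_
    filter_upwards [fst_mulSmoothAux hχ u] with x hx
    rw [hx]; ring
  have e2 : ∫ x in Ω, inner ℝ ((mulSmoothAux Ω χ hχ u).snd x) v * φ x
      = ∫ x in Ω, (inner ℝ (H1.grad u x) v * (χ x * φ x)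
        + H1.val u x * (fderiv ℝ χ x v * φ x)) := by
    refine integral_congr_ae ?_
    filter_upwards [snd_mulSmoothAux hχ u] with x hx
    rw [hx, inner_add_left, real_inner_smul_left, real_inner_smul_left, inner_gradient_left]; ring
  rw [e1, e2, integral_add i3 i2]
  simp_rw [hd, mul_add] at h
  rw [integral_add i1 i2] at h
  linarith

/-- Multiplication by a smooth compactly supported function on `H¹(Ω)`. -/
def mulSmooth (Ω : Set (Eucl N)) (χ : Eucl N → ℝ) (hχ : IsTestFunction Set.univ χ) :
    H1 Ω →L[ℝ] H1 Ω :=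
  (mulSmoothAux Ω χ hχ).codRestrict (H1 Ω) (mulSmoothAux_mem hχ)

theorem val_mulSmooth {χ : Eucl N → ℝ} (hχ : IsTestFunction Set.univ χ) (u : H1 Ω) :
    H1.val (mulSmooth Ω χ hχ u) =ᵐ[volume.restrict Ω] fun x => χ x * H1.val u x :=
  fst_mulSmoothAux hχ u

theorem grad_mulSmooth {χ : Eucl N → ℝ} (hχ : IsTestFunction Set.univ χ) (u : H1 Ω) :
    H1.grad (mulSmooth Ω χ hχ u) =ᵐ[volume.restrict Ω]
      fun x => χ x • H1.grad u x + H1.val u x • gradient χ x :=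
  snd_mulSmoothAux hχ u

theorem H1.ext_ae (hopen : IsOpen Ω) {u w : H1 Ω}
    (h : H1.val u =ᵐ[volume.restrict Ω] H1.val w) : u = w :=
  H1.val_injective hopen (Lp.ext h)

theorem mulSmooth_ofSmooth (hopen : IsOpen Ω) {χ φ : Eucl N → ℝ}
    (hχ : IsTestFunction Set.univ χ) (hφ : IsTestFunction Set.univ φ) :
    mulSmooth Ω χ hχ (ofSmooth Ω φ hφ) = ofSmooth Ω (fun x => χ x * φ x) (hχ.mul hφ) := by
  refine H1.ext_ae hopen ?_
  filter_upwards [val_mulSmooth hχ (ofSmooth Ω φ hφ), val_ofSmooth hφ (Ω := Ω),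
    val_ofSmooth (hχ.mul hφ) (Ω := Ω)] with x h1 h2 h3
  rw [h1, h2, h3]

theorem mem_smoothAwayFrom_iff (hopen : IsOpen Ω) {K : Set (Eucl N)} {u : H1 Ω} :
    u ∈ smoothAwayFrom Ω K ↔ ∃ (φ : Eucl N → ℝ) (hφ : IsTestFunction Set.univ φ),
      Disjoint (tsupport φ) K ∧ u = ofSmooth Ω φ hφ := by
  constructor
  · rintro ⟨φ, h1, h2, h3, h4⟩
    exact ⟨φ, ⟨h1, h2, Set.subset_univ _⟩, h3, H1.ext_ae hopen (h4.trans (val_ofSmooth _).symm)⟩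
  · rintro ⟨φ, hφ, h3, rfl⟩
    exact ⟨φ, hφ.smooth, hφ.compact, h3, val_ofSmooth hφ⟩

/-- Multiplication is continuous and does not enlarge supports. This is how membership of the
constant 1 spreads to all smooth functions. -/
theorem mulSmooth_mem_H10 (hopen : IsOpen Ω) {K : Set (Eucl N)} {χ : Eucl N → ℝ}
    (hχ : IsTestFunction Set.univ χ) {u : H1 Ω} (hu : u ∈ H10 Ω K) :
    mulSmooth Ω χ hχ u ∈ H10 Ω K := by
  refine map_mem_closure (mulSmooth Ω χ hχ).continuous hu fun w hw => ?_
  obtain ⟨φ, hφ, hd, rfl⟩ := (mem_smoothAwayFrom_iff hopen).1 hw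
  rw [mulSmooth_ofSmooth hopen]
  exact (mem_smoothAwayFrom_iff hopen).2
    ⟨_, hχ.mul hφ, hd.mono_left tsupport_mul_subset_right, rfl⟩

/-- As Ω is bounded, η represents the constant 1 in H¹(Ω). -/
theorem exists_smooth_eq_one (hbdd : Bornology.IsBounded Ω) :
    ∃ η : Eucl N → ℝ, IsTestFunction Set.univ η ∧ ∀ x ∈ Ω, η x = 1 := by
  obtain ⟨R, hR, hsub⟩ := hbdd.subset_closedBall_lt 0 0
  let f : ContDiffBump (0 : Eucl N) := ⟨R, R + 1, hR, by linarith⟩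
  exact ⟨f, ⟨f.contDiff, f.hasCompactSupport, Set.subset_univ _⟩,
    fun x hx => f.one_of_mem_closedBall (hsub hx)⟩

/-! ### Averages, inward mollifiers and convolution -/

section Averages

variable {α β F : Type*} [MeasurableSpace α] [MeasurableSpace β] [NormedAddCommGroup F]

theorem eLpNorm_two_sq {μ : Measure α} (f : α → F) :
    eLpNorm f 2 μ ^ 2 = ∫⁻ x, ‖f x‖ₑ ^ 2 ∂μ := by
  rw [eLpNorm_eq_lintegral_rpow_enorm_toReal (by norm_num) (by norm_num), ← ENNReal.rpow_natCast,
    ← ENNReal.rpow_mul]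
  simp

/-- The `L²` norm of an average is at most the supremum of the `L²` norms. -/
theorem eLpNorm_integral_le [NormedSpace ℝ F] {μ : Measure α} {ν : Measure β} [SFinite μ] [IsProbabilityMeasure ν]
    {f : α → β → F} (hf : StronglyMeasurable (Function.uncurry f)) {C : ENNReal}
    (hC : ∀ᵐ z ∂ν, eLpNorm (fun y => f y z) 2 μ ≤ C) :
    eLpNorm (fun y => ∫ z, f y z ∂ν) 2 μ ≤ C := by
  rw [← ENNReal.pow_le_pow_left_iff two_ne_zero, eLpNorm_two_sq]
  have hsec : ∀ y, AEStronglyMeasurable (f y) ν := fun y =>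
    (hf.comp_measurable measurable_prodMk_left).aestronglyMeasurable
  -- Jensen's inequality, as comparison of L¹ and L² norms for a probability measure; Tonelli then
  -- finishes.
  have h1 : ∀ y, ‖∫ z, f y z ∂ν‖ₑ ^ 2 ≤ ∫⁻ z, ‖f y z‖ₑ ^ 2 ∂ν := fun y => by
    rw [← eLpNorm_two_sq]
    refine pow_le_pow_left' ?_ 2
    refine (enorm_integral_le_lintegral_enorm _).trans ?_
    rw [← eLpNorm_one_eq_lintegral_enorm]
    exact eLpNorm_le_eLpNorm_of_exponent_le (by norm_num) (hsec y)
  calc ∫⁻ y, ‖∫ z, f y z ∂ν‖ₑ ^ 2 ∂μ ≤ ∫⁻ y, ∫⁻ z, ‖f y z‖ₑ ^ 2 ∂ν ∂μ := lintegral_mono h1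
    _ = ∫⁻ z, ∫⁻ y, ‖f y z‖ₑ ^ 2 ∂μ ∂ν :=
        lintegral_lintegral_swap (hf.enorm.pow_const 2).aemeasurable
    _ ≤ ∫⁻ _, C ^ 2 ∂ν := by
        refine lintegral_mono_ae ?_
        filter_upwards [hC] with z hz
        rw [← eLpNorm_two_sq]
        exact pow_le_pow_left' hz 2
    _ = C ^ 2 := by simp

end Averages

/-- A smooth probability density supported in the closed ball of radius `δ` around the origin. -/
structure IsMollifier (δ : ℝ) (ψ : Eucl N → ℝ) : Prop where
  smooth : ContDiff ℝ ∞ ψ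
  compact : HasCompactSupport ψ
  nonneg : ∀ t, 0 ≤ ψ t
  integral_eq_one : ∫ t, ψ t = 1
  norm_le : ∀ t ∈ tsupport ψ, ‖t‖ ≤ δ

/-- `ψ` is a mollifier such that the segment from a point `y` of `Ω ∩ B` to `y - t` stays in `Ω` for
all `t` in the support of `ψ`. -/
structure IsInwardMollifier (Ω B : Set (Eucl N)) (δ : ℝ) (ψ : Eucl N → ℝ) : Prop
    extends IsMollifier δ ψ where
  inward : ∀ y ∈ Ω ∩ B, ∀ t ∈ tsupport ψ, ∀ τ ∈ Set.Icc (0 : ℝ) 1, y - τ • t ∈ Ω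

/-- At a boundary point, move by (r/4)e plus an error of norm at most (r/4)κ: the graph rises by at
most L(r/4)κ and the height grows by at least (r/4)(1 - κ). -/
theorem exists_inward_ball (hopen : IsOpen Ω) (hLip : IsLipschitzSet Ω) {x : Eucl N}
    (hx : x ∈ closure Ω) : ∃ r > 0, ∃ a : Eucl N, ∃ s > 0, ∀ y ∈ Ω ∩ Metric.ball x r,
      ∀ z ∈ Metric.closedBall a s, ∀ τ ∈ Set.Icc (0 : ℝ) 1, y + τ • z ∈ Ω := by
  by_cases hxΩ : x ∈ Ω
  · obtain ⟨r, hr, hball⟩ := Metric.isOpen_iff.1 hopen x hxΩ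
    refine ⟨r / 2, by positivity, 0, r / 2, by positivity, fun y hy z hz τ hτ => hball ?_⟩
    have h1 := hy.2
    rw [mem_ball_iff_norm] at h1 ⊢
    rw [mem_closedBall_zero_iff] at hz
    calc ‖y + τ • z - x‖ = ‖(y - x) + τ • z‖ := by congr 1; abel
      _ ≤ ‖y - x‖ + ‖τ • z‖ := norm_add_le _ _
      _ ≤ ‖y - x‖ + 1 * ‖z‖ := by
          rw [norm_smul, Real.norm_eq_abs, abs_of_nonneg hτ.1]
          gcongr
          exact hτ.2
      _ < r := by linarith
  · have hfr : x ∈ frontier Ω := by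
      rw [hopen.frontier_eq]; exact ⟨hx, hxΩ⟩
    obtain ⟨r, hr, e, he, γ, L, hγ, hgraph⟩ := hLip x hfr
    -- Chosen so that Lκ = 1 - κ, which balances rise and gain; strictness comes from y ∈ Ω.
    set κ : ℝ := 1 / (1 + L) with hκ
    have hL0 : (0 : ℝ) ≤ L := L.2
    have hκ0 : 0 < κ := by positivity
    have hκ1 : κ ≤ 1 := by rw [hκ, div_le_one (by positivity)]; linarith
    have hκL : L * κ = 1 - κ := by rw [hκ]; field_simp; ring
    refine ⟨r / 2, by positivity, (r / 4) • e, r / 4 * κ, by positivity, ?_⟩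
    intro y hy z hz τ hτ
    set w := z - (r / 4) • e with hw
    have hzw : z = (r / 4) • e + w := by rw [hw]; abel
    have hwn : ‖w‖ ≤ r / 4 * κ := by rwa [mem_closedBall_iff_norm] at hz
    have hwn' : ‖w‖ ≤ r / 4 := hwn.trans (mul_le_of_le_one_right (by positivity) hκ1)
    have hyb : ‖y - x‖ < r / 2 := mem_ball_iff_norm.1 hy.2
    have hzn : ‖z‖ ≤ r / 2 := by
      rw [hzw]
      refine (norm_add_le _ _).trans ?_
      rw [norm_smul, he, Real.norm_eq_abs, abs_of_pos (by positivity : 0 < r / 4)]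
      linarith
    have hmem : y + τ • z ∈ Metric.ball x r := by
      rw [mem_ball_iff_norm]
      calc ‖y + τ • z - x‖ = ‖(y - x) + τ • z‖ := by congr 1; abel
        _ ≤ ‖y - x‖ + ‖τ • z‖ := norm_add_le _ _
        _ ≤ ‖y - x‖ + 1 * ‖z‖ := by
            rw [norm_smul, Real.norm_eq_abs, abs_of_nonneg hτ.1]
            gcongr
            exact hτ.2
        _ < r := by linarith
    have hyr : y ∈ Metric.ball x r := by rw [mem_ball_iff_norm]; linarith
    rw [hgraph _ hmem]
    have hy0 := (hgraph y hyr).1 hy.1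
    set P := (Submodule.span ℝ {e})ᗮ.orthogonalProjectionOnto with hP
    have hPe : P e = 0 := by
      rw [hP, Submodule.orthogonalProjectionOnto_eq_zero_iff, Submodule.orthogonal_orthogonal]
      exact Submodule.mem_span_singleton_self e
    have hPz : P z = P w := by rw [hzw, map_add, map_smul, hPe, smul_zero, zero_add]
    have hPw : ‖P w‖ ≤ ‖w‖ := (Submodule.span ℝ {e})ᗮ.norm_orthogonalProjectionOnto_apply_le w
    have hγle : γ (P (y + τ • z)) ≤ γ (P y) + L * (τ * (r / 4 * κ)) := by
      have h1 := hγ.dist_le_mul (P (y + τ • z)) (P y)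
      have h2 : dist (P (y + τ • z)) (P y) ≤ τ * (r / 4 * κ) := by
        rw [dist_eq_norm, map_add, add_sub_cancel_left, map_smul, norm_smul, hPz,
          Real.norm_eq_abs, abs_of_nonneg hτ.1]
        exact mul_le_mul_of_nonneg_left (hPw.trans hwn) hτ.1
      have h3 := (le_abs_self _).trans (h1.trans (mul_le_mul_of_nonneg_left h2 hL0))
      linarith
    have hin : inner ℝ e (y + τ • z) ≥ inner ℝ e y + τ * (r / 4 * (1 - κ)) := by
      have h1 : |inner ℝ e w| ≤ ‖e‖ * ‖w‖ := abs_real_inner_le_norm e w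
      rw [he, one_mul] at h1
      have h2 := (abs_le.1 h1).1
      have h4 : inner ℝ e z = r / 4 + inner ℝ e w := by
        rw [hzw, inner_add_right, real_inner_smul_right, real_inner_self_eq_norm_sq, he]; ring
      rw [inner_add_right, real_inner_smul_right, h4]
      have := mul_le_mul_of_nonneg_left (show r / 4 * (1 - κ) ≤ r / 4 + inner ℝ e w by linarith) hτ.1
      linarith
    have : L * (τ * (r / 4 * κ)) = τ * (r / 4 * (1 - κ)) := by rw [← hκL]; ring
    linarith

theorem exists_inwardMollifier (hopen : IsOpen Ω) (hLip : IsLipschitzSet Ω) {x : Eucl N}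
    (hx : x ∈ closure Ω) :
    ∃ r > 0, ∀ δ > 0, ∃ ψ, IsInwardMollifier Ω (Metric.ball x r) δ ψ := by
  obtain ⟨r, hr, a, s, hs, h⟩ := exists_inward_ball hopen hLip hx
  refine ⟨r, hr, fun δ hδ => ?_⟩
  -- The two bounds keep τε in [0, 1] and the support within radius δ. The bump is centred at -εa
  -- because convolution evaluates at y - t.
  set ε := min 1 (δ / (‖a‖ + s)) with hε
  have hε0 : 0 < ε := by positivity
  have hε1 : ε ≤ 1 := min_le_left _ _
  have hεδ : ε * (‖a‖ + s) ≤ δ := by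
    rw [← le_div_iff₀ (by positivity)]; exact min_le_right _ _
  let f : ContDiffBump (-(ε • a)) := ⟨ε * s / 2, ε * s, by positivity, by
    have : 0 < ε * s := by positivity
    linarith⟩
  have hsupp : ∀ t ∈ tsupport (f.normed volume), ∃ z ∈ Metric.closedBall a s, t = -(ε • z) := by
    intro t ht
    rw [f.tsupport_normed_eq, mem_closedBall_iff_norm] at ht
    have ht' : ‖t - -(ε • a)‖ ≤ ε * s := ht
    refine ⟨-(ε⁻¹ • t), ?_, ?_⟩
    · rw [mem_closedBall_iff_norm]
      have : -(ε⁻¹ • t) - a = -(ε⁻¹ • (t - -(ε • a))) := by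
        rw [sub_neg_eq_add, smul_add, smul_smul, inv_mul_cancel₀ hε0.ne', one_smul]; abel
      rw [this, norm_neg, norm_smul, norm_inv, Real.norm_eq_abs, abs_of_pos hε0,
        inv_mul_le_iff₀ hε0]
      exact ht'
    · rw [smul_neg, smul_smul, mul_inv_cancel₀ hε0.ne', one_smul, neg_neg]
  refine ⟨f.normed volume, ⟨⟨f.contDiff_normed, f.hasCompactSupport_normed, f.nonneg_normed,
    f.integral_normed, ?_⟩, ?_⟩⟩
  · intro t ht
    obtain ⟨z, hz, rfl⟩ := hsupp t ht
    rw [norm_neg, norm_smul, Real.norm_eq_abs, abs_of_pos hε0]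
    refine le_trans (mul_le_mul_of_nonneg_left ?_ hε0.le) hεδ
    rw [mem_closedBall_iff_norm] at hz
    have := norm_le_norm_add_norm_sub' z a
    linarith
  · intro y hy t ht τ hτ
    obtain ⟨z, hz, rfl⟩ := hsupp t ht
    have := h y hy z hz (τ * ε) ⟨mul_nonneg hτ.1 hε0.le, mul_le_one₀ hτ.2 hε0.le hε1⟩
    rwa [smul_neg, sub_neg_eq_add, smul_smul]

/-- Continuity of translations in L², at 0. -/
theorem exists_eLpNorm_translate_le {F : Type*} [NormedAddCommGroup F]
    {f : Eucl N → F} (hf : MemLp f 2) {ε : ENNReal} (hε : ε ≠ 0) :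
    ∃ δ > 0, ∀ t : Eucl N, ‖t‖ ≤ δ → eLpNorm (fun y => f (y - t) - f y) 2 ≤ ε := by
  have : Fact ((2 : ENNReal) ≠ ⊤) := ⟨by norm_num⟩
  have hc : Continuous fun t : Eucl N => (DomAddAct.mk (-t) : (Eucl N)ᵈᵃᵃ) +ᵥ hf.toLp f :=
    (DomAddAct.continuous_mk.comp continuous_neg).vadd continuous_const
  have h0 := hc.tendsto 0
  rw [EMetric.tendsto_nhds] at h0
  obtain ⟨δ, hδ, hball⟩ := Metric.eventually_nhds_iff.1 (h0 ε (pos_iff_ne_zero.2 hε))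
  refine ⟨δ / 2, by positivity, fun t ht => ?_⟩
  have h1 := (@hball t (by rw [dist_zero_right]; linarith)).le
  rw [DomAddAct.mk_vadd_toLp, DomAddAct.mk_vadd_toLp, Lp.edist_toLp_toLp] at h1
  refine le_trans (le_of_eq ?_) h1
  congr 1
  ext y
  simp [sub_eq_neg_add]

section Mollify

variable {F : Type*} [NormedAddCommGroup F] [NormedSpace ℝ F]

/-- The convolution of `f` with the kernel `ψ`. -/
def mollify (ψ : Eucl N → ℝ) (f : Eucl N → F) (y : Eucl N) : F := ∫ t, ψ t • f (y - t)

theorem mollify_eq_convolution (ψ : Eucl N → ℝ) (f : Eucl N → F) :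
    mollify ψ f = convolution ψ f (ContinuousLinearMap.lsmul ℝ ℝ) volume := rfl

theorem mollify_eq_swap (ψ : Eucl N → ℝ) (f : Eucl N → F) (y : Eucl N) :
    mollify ψ f y = ∫ x, ψ (y - x) • f x := by
  rw [mollify_eq_convolution, convolution_lsmul_swap]

/-- The probability measure with density `ψ`. -/
def kernelMeasure (ψ : Eucl N → ℝ) : Measure (Eucl N) :=
  volume.withDensity fun t => ENNReal.ofReal (ψ t)

theorem IsMollifier.integrable {δ : ℝ} {ψ : Eucl N → ℝ} (h : IsMollifier δ ψ) : Integrable ψ :=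
  h.smooth.continuous.integrable_of_hasCompactSupport h.compact

theorem IsMollifier.isProbabilityMeasure {δ : ℝ} {ψ : Eucl N → ℝ} (h : IsMollifier δ ψ) :
    IsProbabilityMeasure (kernelMeasure ψ) := by
  refine ⟨?_⟩
  rw [kernelMeasure, withDensity_apply _ MeasurableSet.univ, Measure.restrict_univ,
    ← ofReal_integral_eq_lintegral_ofReal h.integrable (Eventually.of_forall h.nonneg),
    h.integral_eq_one, ENNReal.ofReal_one]

theorem IsMollifier.integral_kernelMeasure {δ : ℝ} {ψ : Eucl N → ℝ} (h : IsMollifier δ ψ)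
    (g : Eucl N → F) : ∫ t, g t ∂(kernelMeasure ψ) = ∫ t, ψ t • g t := by
  rw [kernelMeasure, integral_withDensity_eq_integral_toReal_smul
    h.smooth.continuous.measurable.ennreal_ofReal (by simp)]
  simp_rw [ENNReal.toReal_ofReal (h.nonneg _)]

theorem IsMollifier.ae_mem_tsupport {δ : ℝ} {ψ : Eucl N → ℝ} (h : IsMollifier δ ψ) :
    ∀ᵐ t ∂(kernelMeasure ψ), t ∈ tsupport ψ := by
  rw [kernelMeasure, ae_withDensity_iff h.smooth.continuous.measurable.ennreal_ofReal]
  refine Eventually.of_forall fun t ht => subset_tsupport _ fun h0 => ht ?_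
  rw [h0, ENNReal.ofReal_zero]

theorem IsMollifier.eLpNorm_average_le {δ : ℝ} {ψ : Eucl N → ℝ} (h : IsMollifier δ ψ)
    {μ : Measure (Eucl N)} [SFinite μ] {f : Eucl N → Eucl N → F}
    (hf : StronglyMeasurable (Function.uncurry f)) {C : ENNReal}
    (hC : ∀ t ∈ tsupport ψ, eLpNorm (fun y => f y t) 2 μ ≤ C) :
    eLpNorm (fun y => ∫ t, ψ t • f y t) 2 μ ≤ C := by
  have := h.isProbabilityMeasure
  simp_rw [← h.integral_kernelMeasure]
  refine eLpNorm_integral_le hf ?_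
  filter_upwards [h.ae_mem_tsupport] with t ht using hC t ht

theorem IsMollifier.mollify_sub {δ : ℝ} {ψ : Eucl N → ℝ} (h : IsMollifier δ ψ)
    {f : Eucl N → F} (hf : LocallyIntegrable f) [CompleteSpace F] (y : Eucl N) :
    mollify ψ f y - f y = ∫ t, ψ t • (f (y - t) - f y) := by
  have h1 : Integrable (fun t => ψ t • f (y - t)) :=
    h.compact.convolutionExists_left (ContinuousLinearMap.lsmul ℝ ℝ) h.smooth.continuous hf y
  simp_rw [smul_sub]
  rw [integral_sub h1 (h.integrable.smul_const _), integral_smul_const, h.integral_eq_one, one_smul]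
  rfl

/-- The error is an average of translation errors. Only the size of the support of ψ matters, so
off-centre kernels are allowed. -/
theorem exists_eLpNorm_mollify_sub_le [CompleteSpace F] {f : Eucl N → F} (hf : MemLp f 2)
    (hfm : StronglyMeasurable f) {ε : ENNReal} (hε : ε ≠ 0) :
    ∃ δ > 0, ∀ ψ, IsMollifier δ ψ → eLpNorm (fun y => mollify ψ f y - f y) 2 ≤ ε := by
  obtain ⟨δ, hδ, h⟩ := exists_eLpNorm_translate_le hf hε
  refine ⟨δ, hδ, fun ψ hψ => ?_⟩
  simp_rw [hψ.mollify_sub (hf.locallyIntegrable (by norm_num))]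
  refine hψ.eLpNorm_average_le ?_ fun t ht => h t (hψ.norm_le t ht)
  exact (hfm.comp_measurable (measurable_fst.sub measurable_snd)).sub
    (hfm.comp_measurable measurable_fst)

end Mollify

/-! ### Localization and density of smooth functions -/

/-- Gluing of smooth cutoff functions over the compact set `closure Ω`. -/
theorem exists_cutoff (hbdd : Bornology.IsBounded Ω) {P : (Eucl N → ℝ) → Prop} (hzero : P 0)
    (hloc : ∀ x ∈ closure Ω, ∃ χ : Eucl N → ℝ, IsTestFunction Set.univ χ ∧ P χ ∧
      ∀ᶠ y in 𝓝 x, χ y = 1)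
    (hglue : ∀ χ₁ χ₂ : Eucl N → ℝ, IsTestFunction Set.univ χ₁ → IsTestFunction Set.univ χ₂ →
      P χ₁ → P χ₂ → P (fun x => χ₁ x + χ₂ x - χ₁ x * χ₂ x)) :
    ∃ χ : Eucl N → ℝ, IsTestFunction Set.univ χ ∧ P χ ∧ ∀ x ∈ closure Ω, χ x = 1 := by
  have hcomp : IsCompact (closure Ω) := hbdd.isCompact_closure
  refine hcomp.induction_on (p := fun s => ∃ χ : Eucl N → ℝ, IsTestFunction Set.univ χ ∧ P χ ∧
    ∀ x ∈ s, χ x = 1) ?_ ?_ ?_ ?_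
  · exact ⟨0, ⟨contDiff_const, HasCompactSupport.zero, Set.subset_univ _⟩, hzero, by simp⟩
  · rintro s t hst ⟨χ, h1, h2, h3⟩
    exact ⟨χ, h1, h2, fun x hx => h3 x (hst hx)⟩
  · rintro s t ⟨χ₁, h1, h2, h3⟩ ⟨χ₂, k1, k2, k3⟩
    -- 1 - (1 - χ₁)(1 - χ₂) equals 1 wherever one of the two cutoffs does.
    refine ⟨_, (h1.add k1).sub (h1.mul k1), hglue χ₁ χ₂ h1 k1 h2 k2, ?_⟩
    rintro x (hx | hx)
    · simp only [h3 x hx]; ring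
    · simp only [k3 x hx]; ring
  · intro x hx
    obtain ⟨χ, h1, h2, h3⟩ := hloc x hx
    exact ⟨{y | χ y = 1}, mem_nhdsWithin_of_mem_nhds h3, χ, h1, h2, fun y hy => hy⟩

/-- Gluing becomes an operator identity, so properties stable under sums and composition pass from
local cutoffs to the identity. -/
theorem mulSmooth_glue (hopen : IsOpen Ω) {χ₁ χ₂ : Eucl N → ℝ} (h₁ : IsTestFunction Set.univ χ₁)
    (h₂ : IsTestFunction Set.univ χ₂)
    (h : IsTestFunction Set.univ (fun x => χ₁ x + χ₂ x - χ₁ x * χ₂ x)) :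
    mulSmooth Ω _ h = mulSmooth Ω χ₁ h₁ + mulSmooth Ω χ₂ h₂
      - (mulSmooth Ω χ₁ h₁).comp (mulSmooth Ω χ₂ h₂) := by
  ext1 u
  refine H1.ext_ae hopen ?_
  have e : H1.val ((mulSmooth Ω χ₁ h₁ + mulSmooth Ω χ₂ h₂
      - (mulSmooth Ω χ₁ h₁).comp (mulSmooth Ω χ₂ h₂)) u) =
      H1.val (mulSmooth Ω χ₁ h₁ u) + H1.val (mulSmooth Ω χ₂ h₂ u)
        - H1.val (mulSmooth Ω χ₁ h₁ (mulSmooth Ω χ₂ h₂ u)) := rfl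
  rw [e]
  filter_upwards [val_mulSmooth h u, val_mulSmooth h₁ u, val_mulSmooth h₂ u,
    val_mulSmooth h₁ (mulSmooth Ω χ₂ h₂ u),
    Lp.coeFn_sub (H1.val (mulSmooth Ω χ₁ h₁ u) + H1.val (mulSmooth Ω χ₂ h₂ u))
      (H1.val (mulSmooth Ω χ₁ h₁ (mulSmooth Ω χ₂ h₂ u))),
    Lp.coeFn_add (H1.val (mulSmooth Ω χ₁ h₁ u)) (H1.val (mulSmooth Ω χ₂ h₂ u))]
    with x a1 a2 a3 a4 a5 a6
  rw [a5, Pi.sub_apply, a6, Pi.add_apply, a1, a2, a3, a4, a3]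
  ring

theorem mulSmooth_eq_self (hopen : IsOpen Ω) {χ : Eucl N → ℝ} (hχ : IsTestFunction Set.univ χ)
    (hone : ∀ x ∈ Ω, χ x = 1) (u : H1 Ω) : mulSmooth Ω χ hχ u = u := by
  refine H1.ext_ae hopen ?_
  filter_upwards [val_mulSmooth hχ u, ae_restrict_mem hopen.measurableSet] with x h1 h2
  rw [h1, hone x h2, one_mul]

theorem mulSmooth_zero (hopen : IsOpen Ω) (h : IsTestFunction Set.univ (0 : Eucl N → ℝ)) :
    mulSmooth Ω 0 h = 0 := by
  ext1 u
  refine H1.ext_ae hopen ?_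
  have e : H1.val ((0 : H1 Ω →L[ℝ] H1 Ω) u) = 0 := rfl
  rw [e]
  filter_upwards [val_mulSmooth h u, Lp.coeFn_zero ℝ 2 (volume.restrict Ω)] with x h1 h2
  rw [h1, h2]; simp

/-- Cutoff functions supported in a given ball. -/
theorem exists_local_cutoff (x : Eucl N) {r : ℝ} (hr : 0 < r) :
    ∃ χ : Eucl N → ℝ, IsTestFunction (Metric.ball x r) χ ∧ (∀ᶠ y in 𝓝 x, χ y = 1) ∧
      ∀ y, |χ y| ≤ 1 := by
  let f : ContDiffBump x := ⟨r / 4, r / 2, by positivity, by linarith⟩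
  refine ⟨f, ⟨f.contDiff, f.hasCompactSupport, ?_⟩, f.eventuallyEq_one, fun y => ?_⟩
  · rw [f.tsupport_eq]
    exact Metric.closedBall_subset_ball (by show r / 2 < r; linarith)
  · rw [abs_of_nonneg f.nonneg]; exact f.le_one

theorem memLp_indicator {F : Type*} [NormedAddCommGroup F] (hopen : IsOpen Ω)
    (f : Lp F 2 (volume.restrict Ω)) : MemLp (Ω.indicator f) 2 volume :=
  (memLp_indicator_iff_restrict hopen.measurableSet).2 (Lp.memLp f)

theorem stronglyMeasurable_indicator {F : Type*} [NormedAddCommGroup F] (hopen : IsOpen Ω)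
    (f : Lp F 2 (volume.restrict Ω)) : StronglyMeasurable (Ω.indicator f) :=
  (Lp.stronglyMeasurable f).indicator hopen.measurableSet

theorem IsMollifier.contDiff_mollify {δ : ℝ} {ψ : Eucl N → ℝ} (h : IsMollifier δ ψ)
    {f : Eucl N → ℝ} (hf : LocallyIntegrable f) : ContDiff ℝ ∞ (mollify ψ f) := by
  rw [mollify_eq_convolution]
  exact h.compact.contDiff_convolution_left _ h.smooth hf

theorem IsMollifier.mono {δ δ' : ℝ} {ψ : Eucl N → ℝ} (h : IsMollifier δ ψ) (hle : δ ≤ δ') :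
    IsMollifier δ' ψ :=
  ⟨h.smooth, h.compact, h.nonneg, h.integral_eq_one, fun t ht => (h.norm_le t ht).trans hle⟩

/-- Near the boundary the gradient of the inward mollification is the mollification of the weak
gradient. -/
theorem IsInwardMollifier.gradient_mollify (hopen : IsOpen Ω) {B : Set (Eucl N)} {δ : ℝ}
    {ψ : Eucl N → ℝ} (h : IsInwardMollifier Ω B δ ψ) (u : H1 Ω) {y : Eucl N} (hy : y ∈ Ω ∩ B) :
    gradient (mollify ψ (Ω.indicator (H1.val u))) y
      = mollify ψ (Ω.indicator (H1.grad u)) y := by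
  have hu : LocallyIntegrable (Ω.indicator (H1.val u)) :=
    (memLp_indicator hopen (H1.val u)).locallyIntegrable (by norm_num)
  have hg : LocallyIntegrable (Ω.indicator (H1.grad u)) :=
    (memLp_indicator hopen (H1.grad u)).locallyIntegrable (by norm_num)
  -- Inwardness at τ = 1 makes the reflected kernel an admissible test function in Ω.
  have htest : IsTestFunction Ω (fun x => ψ (y - x)) := by
    have hcs : HasCompactSupport (fun x => ψ (y - x)) :=
      h.compact.comp_homeomorph (Homeomorph.subLeft y)
    refine ⟨h.smooth.comp (contDiff_const.sub contDiff_id), hcs, fun x hx => ?_⟩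
    have hx' : y - x ∈ tsupport ψ :=
      tsupport_comp_subset_preimage ψ (continuous_const.sub continuous_id) hx
    simpa using h.inward y hy (y - x) hx' 1 ⟨zero_le_one, le_rfl⟩
  refine ext_inner_right ℝ fun v => ?_
  have hder := (h.compact.hasFDerivAt_convolution_left (ContinuousLinearMap.lsmul ℝ ℝ)
    (h.smooth.of_le (by simp)) hu y).fderiv
  have hex := (h.compact.fderiv ℝ).convolutionExists_left
    ((ContinuousLinearMap.lsmul ℝ ℝ).precompL (Eucl N)) (h.smooth.continuous_fderiv (by simp)) hu y
  have e1 : fderiv ℝ (mollify ψ (Ω.indicator (H1.val u))) y v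
      = ∫ x in Ω, fderiv ℝ ψ (y - x) v * H1.val u x := by
    rw [mollify_eq_convolution, hder, convolution_def, ContinuousLinearMap.integral_apply hex,
      ← integral_sub_left_eq_self _ volume y, ← integral_indicator hopen.measurableSet]
    refine integral_congr_ae (Eventually.of_forall fun x => ?_)
    by_cases hx : x ∈ Ω <;> simp [hx, ContinuousLinearMap.precompL_apply]
  have hfd : ∀ x, fderiv ℝ (fun x => ψ (y - x)) x v = -fderiv ℝ ψ (y - x) v := fun x => by
    have := (((h.smooth.differentiable (by simp)) (y - x)).hasFDerivAt).comp x
      ((hasFDerivAt_id x).const_sub y)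
    rw [show (fun x => ψ (y - x)) = ψ ∘ (HSub.hSub y) from rfl, this.fderiv]
    simp
  have hw := H1.isWeakGradient u _ htest v
  simp_rw [hfd] at hw
  have e2 : inner ℝ (mollify ψ (Ω.indicator (H1.grad u)) y) v
      = ∫ x in Ω, inner ℝ (H1.grad u x) v * ψ (y - x) := by
    have hint : Integrable (fun x => ψ (y - x) • Ω.indicator (H1.grad u) x) := by
      have := (h.compact.convolutionExists_left (ContinuousLinearMap.lsmul ℝ ℝ)
        h.smooth.continuous hg y).comp_sub_left y
      simpa using this
    rw [mollify_eq_swap, real_inner_comm, ← integral_inner hint,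
      ← integral_indicator hopen.measurableSet]
    refine integral_congr_ae (Eventually.of_forall fun x => ?_)
    by_cases hx : x ∈ Ω
    · simp [hx, real_inner_smul_right, real_inner_comm, mul_comm]
    · simp [hx]
  rw [inner_gradient_left, e1, e2]
  have e3 : ∫ x in Ω, H1.val u x * -fderiv ℝ ψ (y - x) v
      = -∫ x in Ω, fderiv ℝ ψ (y - x) v * H1.val u x := by
    rw [← integral_neg]
    exact integral_congr_ae (Eventually.of_forall fun x => by simp only; ring)
  rw [e3, neg_inj] at hw
  exact hw

theorem H1.norm_le_add (u : H1 Ω) : ‖u‖ ≤ ‖H1.val u‖ + ‖H1.grad u‖ := by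
  have h := H1.norm_sq u
  refine abs_le_of_sq_le_sq' ?_ (by positivity) |>.2
  nlinarith [norm_nonneg (H1.val u), norm_nonneg (H1.grad u),
    mul_nonneg (norm_nonneg (H1.val u)) (norm_nonneg (H1.grad u))]

theorem Lp_norm_le_of_eLpNorm_le {α F : Type*} [MeasurableSpace α] {μ : Measure α}
    [NormedAddCommGroup F] (f : Lp F 2 μ) {g : α → F} (hfg : f =ᵐ[μ] g) {C : ℝ} (hC : 0 ≤ C)
    (h : eLpNorm g 2 μ ≤ ENNReal.ofReal C) : ‖f‖ ≤ C := by
  rw [Lp.norm_def, eLpNorm_congr_ae hfg]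
  exact ENNReal.toReal_le_of_le_ofReal hC h

theorem eLpNorm_smul_le_of_bound {α F : Type*} [MeasurableSpace α] {μ : Measure α}
    [NormedAddCommGroup F] {f g : α → F} {C ε : ℝ} (hC : 0 ≤ C)
    (hfg : ∀ᵐ x ∂μ, ‖f x‖ ≤ C * ‖g x‖) (hg : eLpNorm g 2 μ ≤ ENNReal.ofReal ε) :
    eLpNorm f 2 μ ≤ ENNReal.ofReal (C * ε) := by
  refine (eLpNorm_le_mul_eLpNorm_of_ae_le_mul hfg 2).trans ?_
  rw [ENNReal.ofReal_mul hC]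
  gcongr

theorem IsTestFunction.exists_bound {φ : Eucl N → ℝ} (h : IsTestFunction Ω φ) :
    ∃ C ≥ 0, ∀ x, |φ x| ≤ C ∧ ‖gradient φ x‖ ≤ C := by
  obtain ⟨C₁, h₁⟩ := h.compact.exists_bound_of_continuous h.smooth.continuous
  obtain ⟨C₂, h₂⟩ := h.compact_gradient.exists_bound_of_continuous h.continuous_gradient
  exact ⟨max C₁ C₂, le_max_of_le_left ((norm_nonneg _).trans (h₁ 0)),
    fun x => ⟨le_max_of_le_left (h₁ x), le_max_of_le_right (h₂ x)⟩⟩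

/-- By the product rule the error consists of three terms, each at most Cε: one in the value, two in
the gradient. -/
theorem IsInwardMollifier.dist_mulSmooth_le (hopen : IsOpen Ω) {B : Set (Eucl N)} {δ ε C : ℝ}
    {ψ χ : Eucl N → ℝ} (h : IsInwardMollifier Ω B δ ψ) (u : H1 Ω)
    (hχ : IsTestFunction B χ) (hC0 : 0 ≤ C) (hε0 : 0 ≤ ε)
    (hC : ∀ x, |χ x| ≤ C ∧ ‖gradient χ x‖ ≤ C)
    (hu : eLpNorm (fun y => mollify ψ (Ω.indicator (H1.val u)) y - Ω.indicator (H1.val u) y) 2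
      ≤ ENNReal.ofReal ε)
    (hg : eLpNorm (fun y => mollify ψ (Ω.indicator (H1.grad u)) y - Ω.indicator (H1.grad u) y) 2
      ≤ ENNReal.ofReal ε)
    (hφ : IsTestFunction Set.univ (fun x => mollify ψ (Ω.indicator (H1.val u)) x * χ x)) :
    ‖ofSmooth Ω _ hφ - mulSmooth Ω χ (hχ.mono (Set.subset_univ _)) u‖ ≤ 3 * C * ε := by
  set ut := Ω.indicator (H1.val u) with hut
  set gt := Ω.indicator (H1.grad u) with hgt
  have hχ' := hχ.mono (Set.subset_univ B)
  have hloc : LocallyIntegrable ut :=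
    (memLp_indicator hopen (H1.val u)).locallyIntegrable (by norm_num)
  have hwd := h.contDiff_mollify hloc
  have hmeas : AEStronglyMeasurable (mollify ψ ut) (volume.restrict Ω) :=
    hwd.continuous.aestronglyMeasurable
  have hu' := (eLpNorm_mono_measure (fun y => mollify ψ ut y - ut y)
    (Measure.restrict_le_self (s := Ω))).trans hu
  have hg' := (eLpNorm_mono_measure (fun y => mollify ψ gt y - gt y)
    (Measure.restrict_le_self (s := Ω))).trans hg
  have hvalue : ‖H1.val (ofSmooth Ω _ hφ - mulSmooth Ω χ hχ' u)‖ ≤ C * ε := by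
    refine Lp_norm_le_of_eLpNorm_le _ (g := fun x => χ x * (mollify ψ ut x - ut x)) ?_
      (by positivity) (eLpNorm_smul_le_of_bound hC0 (Eventually.of_forall fun x => ?_) hu')
    · have e : H1.val (ofSmooth Ω _ hφ - mulSmooth Ω χ hχ' u)
        = H1.val (ofSmooth Ω _ hφ) - H1.val (mulSmooth Ω χ hχ' u) := rfl
      rw [e]
      filter_upwards [val_ofSmooth hφ (Ω := Ω), val_mulSmooth hχ' u,
        Lp.coeFn_sub (H1.val (ofSmooth Ω _ hφ)) (H1.val (mulSmooth Ω χ hχ' u)),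
        ae_restrict_mem hopen.measurableSet] with x h1 h2 h3 h4
      rw [h3, Pi.sub_apply, h1, h2, hut, Set.indicator_of_mem h4]
      ring
    · rw [norm_mul]
      exact mul_le_mul_of_nonneg_right (hC x).1 (norm_nonneg _)
  have hgrad : ‖H1.grad (ofSmooth Ω _ hφ - mulSmooth Ω χ hχ' u)‖ ≤ C * ε + C * ε := by
    refine Lp_norm_le_of_eLpNorm_le _ (g := (fun x => χ x • (mollify ψ gt x - gt x))
      + fun x => (mollify ψ ut x - ut x) • gradient χ x) ?_ (by positivity) ?_
    · have e : H1.grad (ofSmooth Ω _ hφ - mulSmooth Ω χ hχ' u)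
        = H1.grad (ofSmooth Ω _ hφ) - H1.grad (mulSmooth Ω χ hχ' u) := rfl
      rw [e]
      filter_upwards [grad_ofSmooth hφ (Ω := Ω), grad_mulSmooth hχ' u,
        Lp.coeFn_sub (H1.grad (ofSmooth Ω _ hφ)) (H1.grad (mulSmooth Ω χ hχ' u)),
        ae_restrict_mem hopen.measurableSet] with x h1 h2 h3 h4
      rw [h3, Pi.sub_apply, h1, h2, gradient_mul (hwd.differentiable (by simp) x)
        (hχ.smooth.differentiable (by simp) x), Pi.add_apply, hut, hgt,
        Set.indicator_of_mem h4, Set.indicator_of_mem h4, ← hut, ← hgt]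
      -- Gradient and mollification commute only on Ω ∩ B; elsewhere the factor χ kills that term.
      by_cases hx : x ∈ B
      · rw [h.gradient_mollify hopen u ⟨h4, hx⟩, ← hgt, smul_sub, sub_smul]
        abel
      · rw [hχ.eq_zero hx]
        simp [sub_smul]
    · have hmg : AEStronglyMeasurable (mollify ψ gt) (volume.restrict Ω) := by
        have : Continuous (mollify ψ gt) := by
          rw [mollify_eq_convolution]
          exact h.compact.continuous_convolution_left _ h.smooth.continuous
            ((memLp_indicator hopen (H1.grad u)).locallyIntegrable (by norm_num))
        exact this.aestronglyMeasurable
      have m1 : AEStronglyMeasurable (fun x => χ x • (mollify ψ gt x - gt x))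
          (volume.restrict Ω) := hχ.smooth.continuous.aestronglyMeasurable.smul
        (hmg.sub (stronglyMeasurable_indicator hopen _).aestronglyMeasurable)
      have m2 : AEStronglyMeasurable (fun x => (mollify ψ ut x - ut x) • gradient χ x)
          (volume.restrict Ω) :=
        (hmeas.sub (stronglyMeasurable_indicator hopen _).aestronglyMeasurable).smul
          hχ.continuous_gradient.aestronglyMeasurable
      refine (eLpNorm_add_le m1 m2 (by norm_num)).trans ?_
      rw [ENNReal.ofReal_add (by positivity) (by positivity)]
      refine add_le_add (eLpNorm_smul_le_of_bound hC0 (Eventually.of_forall fun x => ?_) hg') ?_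
      · rw [norm_smul]
        exact mul_le_mul_of_nonneg_right (hC x).1 (norm_nonneg _)
      · rw [← eLpNorm_norm] at hu' ⊢
        refine eLpNorm_smul_le_of_bound hC0 (Eventually.of_forall fun x => ?_) hu'
        rw [norm_norm, norm_norm, norm_smul, mul_comm]
        exact mul_le_mul_of_nonneg_right (hC x).2 (norm_nonneg _)
  have := H1.norm_le_add (ofSmooth Ω _ hφ - mulSmooth Ω χ hχ' u)
  linarith

theorem mulSmooth_mem_H10_empty (hopen : IsOpen Ω) {x : Eucl N} {r : ℝ}
    (hr : ∀ δ > 0, ∃ ψ, IsInwardMollifier Ω (Metric.ball x r) δ ψ) {χ : Eucl N → ℝ}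
    (hχ : IsTestFunction (Metric.ball x r) χ) (u : H1 Ω) :
    mulSmooth Ω χ (hχ.mono (Set.subset_univ _)) u ∈ H10 Ω ∅ := by
  obtain ⟨C, hC0, hC⟩ := hχ.exists_bound
  refine Metric.mem_closure_iff.2 fun η hη => ?_
  -- Makes 3Cε < η, also when C = 0.
  set ε := η / (3 * C + 1) with hε
  have hε0 : 0 < ε := by positivity
  have hne : ENNReal.ofReal ε ≠ 0 := (ENNReal.ofReal_pos.2 hε0).ne'
  obtain ⟨δ₁, hδ₁, h₁⟩ := exists_eLpNorm_mollify_sub_le (memLp_indicator hopen (H1.val u))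
    (stronglyMeasurable_indicator hopen _) hne
  obtain ⟨δ₂, hδ₂, h₂⟩ := exists_eLpNorm_mollify_sub_le (memLp_indicator hopen (H1.grad u))
    (stronglyMeasurable_indicator hopen _) hne
  obtain ⟨ψ, hψ⟩ := hr (min δ₁ δ₂) (lt_min hδ₁ hδ₂)
  have hφ : IsTestFunction Set.univ (fun x => mollify ψ (Ω.indicator (H1.val u)) x * χ x) :=
    ⟨(hψ.contDiff_mollify ((memLp_indicator hopen (H1.val u)).locallyIntegrable
      (by norm_num))).mul hχ.smooth, hχ.compact.mul_left, Set.subset_univ _⟩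
  refine ⟨ofSmooth Ω _ hφ, (mem_smoothAwayFrom_iff hopen).2 ⟨_, hφ, by simp, rfl⟩, ?_⟩
  rw [dist_comm, dist_eq_norm]
  refine (hψ.dist_mulSmooth_le hopen u hχ hC0 hε0.le hC
    (h₁ ψ (hψ.toIsMollifier.mono (min_le_left _ _)))
    (h₂ ψ (hψ.toIsMollifier.mono (min_le_right _ _))) hφ).trans_lt ?_
  rw [hε, ← mul_div_assoc, div_lt_iff₀ (by positivity)]
  nlinarith

/-- Restrictions of smooth compactly supported functions are dense in `H¹(Ω)`. -/
theorem H10_empty (hopen : IsOpen Ω) (hbdd : Bornology.IsBounded Ω) (hLip : IsLipschitzSet Ω) :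
    H10 Ω (∅ : Set (Eucl N)) = ⊤ := by
  obtain ⟨χ, hχ, hP, hone⟩ := exists_cutoff hbdd
    (P := fun χ => ∀ (hχ : IsTestFunction Set.univ χ) (u : H1 Ω), mulSmooth Ω χ hχ u ∈ H10 Ω ∅)
    (fun h u => by rw [mulSmooth_zero hopen]; exact Submodule.zero_mem _)
    (fun x hx => by
      obtain ⟨r, hr, hmol⟩ := exists_inwardMollifier hopen hLip hx
      obtain ⟨χ, hχ, h1, -⟩ := exists_local_cutoff x hr
      exact ⟨χ, hχ.mono (Set.subset_univ _),
        fun _ u => mulSmooth_mem_H10_empty hopen hmol hχ u, h1⟩)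
    (fun χ₁ χ₂ h₁ h₂ p₁ p₂ h u => by
      rw [mulSmooth_glue hopen h₁ h₂ h]
      exact Submodule.sub_mem _ (Submodule.add_mem _ (p₁ h₁ u) (p₂ h₂ u)) (p₁ h₁ _))
  refine Submodule.eq_top_iff'.2 fun u => ?_
  rw [← mulSmooth_eq_self hopen hχ (fun x hx => hone x (subset_closure hx)) u]
  exact hP hχ u

theorem dense_ofSmooth (hopen : IsOpen Ω) (hbdd : Bornology.IsBounded Ω)
    (hLip : IsLipschitzSet Ω) {S : Set (H1 Ω)} (hS : IsClosed S)
    (h : ∀ φ (hφ : IsTestFunction Set.univ φ), ofSmooth Ω φ hφ ∈ S) (u : H1 Ω) : u ∈ S := by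
  have hu : u ∈ H10 Ω (∅ : Set (Eucl N)) := by rw [H10_empty hopen hbdd hLip]; trivial
  refine closure_minimal (fun w hw => ?_) hS hu
  obtain ⟨φ, hφ, -, rfl⟩ := (mem_smoothAwayFrom_iff hopen).1 hw
  exact h φ hφ

/-! ### Hilbert–Schmidt operators and the Rellich theorem -/

section KernelOperator

variable {α G : Type*} [MeasurableSpace α] {μ : Measure α} [NormedAddCommGroup G]
  [InnerProductSpace ℝ G]

/-- The real inner product as a continuous bilinear map. -/
def realInnerL (G : Type*) [NormedAddCommGroup G] [InnerProductSpace ℝ G] : G →L[ℝ] G →L[ℝ] ℝ :=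
  (innerₗ G).mkContinuous₂ 1 fun u v => by simpa using norm_inner_le_norm (𝕜 := ℝ) u v

/-- The operator `f ↦ ⟪f, κ(·)⟫` with square-integrable kernel `κ`. -/
def kernelOp (κ : Lp G 2 μ) : G →L[ℝ] Lp ℝ 2 μ := ((realInnerL G).compLpL₂ 2 μ).flip κ

theorem coeFn_kernelOp (κ : Lp G 2 μ) (f : G) :
    kernelOp κ f =ᵐ[μ] fun y => inner ℝ f (κ y) :=
  (realInnerL G f).coeFn_compLp κ

/-- The operator depends linearly and continuously on κ and has rank at most one when κ is a
constant times an indicator; compact operators form a closed subspace. -/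
theorem isCompactOperator_kernelOp (κ : Lp G 2 μ) : IsCompactOperator (kernelOp κ) := by
  refine Lp.induction (by norm_num) (motive := fun κ => IsCompactOperator (kernelOp κ)) ?_ ?_ ?_ κ
  · intro c s hs hμs
    let S : ℝ →L[ℝ] Lp ℝ 2 μ :=
      ContinuousLinearMap.toSpanSingleton ℝ (indicatorConstLp 2 hs hμs.ne (1 : ℝ))
    have hL : IsCompactOperator (realInnerL G c) :=
      isCompactOperator_of_locallyCompactSpace_dom _
    have heq : kernelOp (Lp.simpleFunc.indicatorConst 2 hs hμs.ne c : Lp G 2 μ)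
        = S.comp (realInnerL G c) := by
      ext1 f
      refine Lp.ext ?_
      have e : (S.comp (realInnerL G c)) f
          = (inner ℝ c f : ℝ) • indicatorConstLp 2 hs hμs.ne (1 : ℝ) := rfl
      rw [e, Lp.simpleFunc.coe_indicatorConst]
      filter_upwards [coeFn_kernelOp (indicatorConstLp 2 hs hμs.ne c) f,
        Lp.coeFn_smul (inner ℝ c f : ℝ) (indicatorConstLp 2 hs hμs.ne (1 : ℝ)),
        indicatorConstLp_coeFn (p := 2) (hs := hs) (hμs := hμs.ne) (c := c),
        indicatorConstLp_coeFn (p := 2) (hs := hs) (hμs := hμs.ne) (c := (1 : ℝ))]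
        with y h1 h2 h3 h4
      rw [h1, h2, Pi.smul_apply, h3, h4]
      by_cases hy : y ∈ s <;> simp [hy, real_inner_comm]
    rw [heq]
    exact hL.clm_comp S
  · intro f g hf hg _ h1 h2
    have : kernelOp (hf.toLp f + hg.toLp g) = kernelOp (hf.toLp f) + kernelOp (hg.toLp g) :=
      map_add _ _ _
    rw [this]
    exact h1.add h2
  · exact isClosed_setOfPred_isCompactOperator.preimage
      ((realInnerL G).compLpL₂ 2 μ).flip.continuous

end KernelOperator

theorem IsMollifier.memLp_shift {δ : ℝ} {ψ : Eucl N → ℝ} (h : IsMollifier δ ψ) (Ω : Set (Eucl N))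
    (y : Eucl N) : MemLp (fun x => ψ (y - x)) 2 (volume.restrict Ω) :=
  ((h.smooth.continuous.comp (continuous_const.sub continuous_id)).memLp_of_hasCompactSupport
    (h.compact.comp_homeomorph (Homeomorph.subLeft y))).restrict Ω

/-- ψ is Lipschitz and Ω has finite measure. This makes the L²-valued kernel measurable and
square-integrable after a cutoff. -/
theorem IsMollifier.continuous_shift (hbdd : Bornology.IsBounded Ω) {δ : ℝ} {ψ : Eucl N → ℝ}
    (h : IsMollifier δ ψ) : Continuous fun y => (h.memLp_shift Ω y).toLp (fun x => ψ (y - x)) := by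
  have : IsFiniteMeasure (volume.restrict Ω) := ⟨by
    rw [Measure.restrict_apply_univ]; exact hbdd.measure_lt_top⟩
  obtain ⟨C, hC⟩ := h.smooth.lipschitzWith_of_hasCompactSupport h.compact (by simp)
  set M : ℝ := (measureUnivNNReal (volume.restrict Ω) : ℝ) ^ (2 : ENNReal).toReal⁻¹
  have hM : 0 ≤ M := Real.rpow_nonneg (NNReal.coe_nonneg _) _
  refine LipschitzWith.continuous (K := (M * C).toNNReal) (LipschitzWith.of_dist_le_mul fun y z => ?_)
  rw [dist_eq_norm, ← MemLp.toLp_sub, Real.coe_toNNReal _ (by positivity), mul_assoc]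
  refine Lp.norm_le_of_ae_bound (by positivity) ?_
  filter_upwards [((h.memLp_shift Ω y).sub (h.memLp_shift Ω z)).coeFn_toLp] with x hx
  rw [hx, Pi.sub_apply, ← dist_eq_norm]
  refine (hC.dist_le_mul _ _).trans (le_of_eq ?_)
  simp [dist_eq_norm]

/-- The kernel of the operator `f ↦ χ (ψ ⋆ f)`. -/
theorem IsMollifier.memLp_kernel (hbdd : Bornology.IsBounded Ω) {δ : ℝ} {ψ χ : Eucl N → ℝ}
    (h : IsMollifier δ ψ) (hχ : IsTestFunction Set.univ χ) :
    MemLp (fun y => χ y • (h.memLp_shift Ω y).toLp (fun x => ψ (y - x))) 2 (volume.restrict Ω) :=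
  ((hχ.smooth.continuous.smul (h.continuous_shift hbdd)).memLp_of_hasCompactSupport
    hχ.compact.smul_right).restrict Ω

/-- The value at y is χ(y) times the L²(Ω) product of f with ψ(y - ·). Allowing any representative g
lets a smooth function replace its class. -/
theorem IsMollifier.exists_compact_mollify (hopen : IsOpen Ω) (hbdd : Bornology.IsBounded Ω) {δ : ℝ}
    {ψ χ : Eucl N → ℝ} (h : IsMollifier δ ψ) (hχ : IsTestFunction Set.univ χ) :
    ∃ T : L2 Ω →L[ℝ] L2 Ω, IsCompactOperator T ∧ ∀ (f : L2 Ω) (g : Eucl N → ℝ),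
      f =ᵐ[volume.restrict Ω] g →
      T f =ᵐ[volume.restrict Ω] fun y => χ y * mollify ψ (Ω.indicator g) y := by
  refine ⟨kernelOp ((h.memLp_kernel hbdd hχ).toLp _), isCompactOperator_kernelOp _, ?_⟩
  intro f g hfg
  filter_upwards [coeFn_kernelOp ((h.memLp_kernel hbdd hχ).toLp _) f,
    (h.memLp_kernel hbdd hχ).coeFn_toLp] with y h1 h2
  rw [h1, h2, real_inner_smul_right, L2.inner_def, mollify_eq_swap,
    show (fun x => ψ (y - x) • Ω.indicator g x) = Ω.indicator (fun x => ψ (y - x) * g x) by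
      ext x; by_cases hx : x ∈ Ω <;> simp [hx], integral_indicator hopen.measurableSet]
  congr 1
  refine integral_congr_ae ?_
  filter_upwards [hfg, (h.memLp_shift Ω y).coeFn_toLp] with x h3 h4
  rw [h3, h4]; simp

/-- The difference is the average over τ of the derivative along a segment contained in Ω; each
slice is bounded by translation invariance. -/
theorem eLpNorm_sub_translate_le (hopen : IsOpen Ω) {A : Set (Eucl N)} (hA : MeasurableSet A)
    {φ : Eucl N → ℝ} (hφ : IsTestFunction Set.univ φ) {t : Eucl N}
    (ht : ∀ y ∈ A, ∀ τ ∈ Set.Icc (0 : ℝ) 1, y - τ • t ∈ Ω) :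
    eLpNorm (fun y => φ y - φ (y - t)) 2 (volume.restrict A)
      ≤ ENNReal.ofReal ‖t‖ * eLpNorm (gradient φ) 2 (volume.restrict Ω) := by
  have hdc : Continuous (fderiv ℝ φ) := hφ.smooth.continuous_fderiv (by simp)
  have hftc : ∀ y, φ y - φ (y - t)
      = ∫ τ, fderiv ℝ φ (y - τ • t) t ∂(volume.restrict (Set.Ioc (0 : ℝ) 1)) := by
    intro y
    have hd : ∀ τ ∈ Set.uIcc (0 : ℝ) 1,
        HasDerivAt (fun τ : ℝ => -φ (y - τ • t)) (fderiv ℝ φ (y - τ • t) t) τ := by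
      intro τ _
      have h1 : HasDerivAt (fun τ : ℝ => y - τ • t) (-t) τ := by
        simpa using ((hasDerivAt_id τ).smul_const t).const_sub y
      have h2 := ((hφ.smooth.differentiable (by simp) (y - τ • t)).hasFDerivAt).comp_hasDerivAt τ h1
      exact h2.neg.congr_deriv (by simp)
    have hc : Continuous fun τ : ℝ => fderiv ℝ φ (y - τ • t) t :=
      (hdc.comp (by fun_prop)).clm_apply continuous_const
    have := intervalIntegral.integral_eq_sub_of_hasDerivAt hd (hc.intervalIntegrable 0 1)
    rw [intervalIntegral.integral_of_le zero_le_one] at this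
    rw [this]; simp; ring
  have hprob : IsProbabilityMeasure (volume.restrict (Set.Ioc (0 : ℝ) 1)) := ⟨by simp⟩
  simp_rw [hftc]
  refine eLpNorm_integral_le ?_ ?_
  · have hc : Continuous fun p : Eucl N × ℝ => fderiv ℝ φ (p.1 - p.2 • t) t :=
      (hdc.comp (by fun_prop)).clm_apply continuous_const
    exact hc.stronglyMeasurable
  · filter_upwards [ae_restrict_mem measurableSet_Ioc] with τ hτ
    have h1 : eLpNorm (fun y => fderiv ℝ φ (y - τ • t) t) 2 (volume.restrict A)
        ≤ ENNReal.ofReal ‖t‖ * eLpNorm (fun y => gradient φ (y - τ • t)) 2 (volume.restrict A) := by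
      refine eLpNorm_le_mul_eLpNorm_of_ae_le_mul (Eventually.of_forall fun y => ?_) 2
      rw [← inner_gradient_left, mul_comm]
      exact norm_inner_le_norm _ _
    refine h1.trans ?_
    gcongr
    have h2 : eLpNorm (fun y => gradient φ (y - τ • t)) 2 (volume.restrict A)
        ≤ eLpNorm (fun y => Ω.indicator (gradient φ) (y - τ • t)) 2 volume := by
      rw [← eLpNorm_indicator_eq_eLpNorm_restrict hA]
      refine eLpNorm_mono fun y => ?_
      by_cases hy : y ∈ A
      · rw [Set.indicator_of_mem hy, Set.indicator_of_mem (ht y hy τ ⟨hτ.1.le, hτ.2⟩)]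
      · rw [Set.indicator_of_notMem hy, norm_zero]; exact norm_nonneg _
    refine h2.trans (le_of_eq ?_)
    rw [← eLpNorm_indicator_eq_eLpNorm_restrict hopen.measurableSet]
    exact eLpNorm_comp_measurePreserving (g := Ω.indicator (gradient φ))
      (hφ.continuous_gradient.aestronglyMeasurable.indicator hopen.measurableSet)
      (measurePreserving_sub_right volume (τ • t))

theorem eLpNorm_gradient_le_norm {φ : Eucl N → ℝ} (hφ : IsTestFunction Set.univ φ) :
    eLpNorm (gradient φ) 2 (volume.restrict Ω) ≤ ENNReal.ofReal ‖ofSmooth Ω φ hφ‖ := by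
  have h1 : ‖H1.grad (ofSmooth Ω φ hφ)‖ ≤ ‖ofSmooth Ω φ hφ‖ := by
    have := H1.norm_sq (ofSmooth Ω φ hφ)
    refine abs_le_of_sq_le_sq' ?_ (norm_nonneg _) |>.2
    nlinarith [sq_nonneg ‖H1.val (ofSmooth Ω φ hφ)‖]
  refine le_trans (le_of_eq ?_) (ENNReal.ofReal_le_ofReal h1)
  rw [Lp.norm_def, ENNReal.ofReal_toReal (Lp.eLpNorm_ne_top _)]
  exact eLpNorm_congr_ae (grad_ofSmooth hφ).symm

/-- On Ω ∩ B the extension by zero is never seen, so the error is an average of differences φ(y) -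
φ(y - t) with ‖t‖ ≤ δ. The bound is uniform in φ, unlike that of `exists_eLpNorm_mollify_sub_le`. -/
theorem IsInwardMollifier.norm_sub_le (hopen : IsOpen Ω) {B : Set (Eucl N)} (hB : MeasurableSet B)
    {δ : ℝ} (hδ : 0 ≤ δ) {ψ χ : Eucl N → ℝ} (h : IsInwardMollifier Ω B δ ψ)
    (hχ : IsTestFunction B χ) (hχ1 : ∀ y, |χ y| ≤ 1)
    {T : L2 Ω →L[ℝ] L2 Ω} (hT : ∀ (f : L2 Ω) (g : Eucl N → ℝ), f =ᵐ[volume.restrict Ω] g →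
      T f =ᵐ[volume.restrict Ω] fun y => χ y * mollify ψ (Ω.indicator g) y)
    {φ : Eucl N → ℝ} (hφ : IsTestFunction Set.univ φ) :
    ‖H1.val (mulSmooth Ω χ (hχ.mono (Set.subset_univ _)) (ofSmooth Ω φ hφ))
      - T (H1.val (ofSmooth Ω φ hφ))‖ ≤ δ * ‖ofSmooth Ω φ hφ‖ := by
  have hχ' := hχ.mono (Set.subset_univ B)
  set D : Eucl N → ℝ := fun y => ∫ t, ψ t • (φ y - φ (y - t)) with hD
  have hA : MeasurableSet (Ω ∩ B) := hopen.measurableSet.inter hB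
  have hDle : eLpNorm D 2 (volume.restrict (Ω ∩ B)) ≤ ENNReal.ofReal (δ * ‖ofSmooth Ω φ hφ‖) := by
    refine h.eLpNorm_average_le (f := fun y t => φ y - φ (y - t)) ?_ fun t ht => ?_
    · have hc : Continuous fun p : Eucl N × Eucl N => φ p.1 - φ (p.1 - p.2) :=
        (hφ.smooth.continuous.comp continuous_fst).sub
          (hφ.smooth.continuous.comp (continuous_fst.sub continuous_snd))
      exact hc.stronglyMeasurable
    · refine (eLpNorm_sub_translate_le hopen hA hφ fun y hy τ hτ => h.inward y hy t ht τ hτ).trans ?_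
      rw [ENNReal.ofReal_mul hδ]
      exact mul_le_mul' (ENNReal.ofReal_le_ofReal (h.norm_le t ht)) (eLpNorm_gradient_le_norm hφ)
  have hloc : LocallyIntegrable (Ω.indicator φ) :=
    (hφ.smooth.continuous.integrable_of_hasCompactSupport hφ.compact).indicator
      hopen.measurableSet |>.locallyIntegrable
  have hpt : ∀ y ∈ Ω ∩ B, φ y - mollify ψ (Ω.indicator φ) y = D y := by
    intro y hy
    have h1 := h.mollify_sub hloc y
    rw [Set.indicator_of_mem hy.1] at h1
    rw [← neg_sub, h1, hD, ← integral_neg]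
    refine integral_congr_ae (Eventually.of_forall fun t => ?_)
    by_cases ht : t ∈ tsupport ψ
    · have := h.inward y hy t ht 1 ⟨zero_le_one, le_rfl⟩
      rw [one_smul] at this
      simp only [Set.indicator_of_mem this, smul_eq_mul]
      ring
    · simp [image_eq_zero_of_notMem_tsupport ht]
  refine Lp_norm_le_of_eLpNorm_le _ (g := fun y => χ y * (φ y - mollify ψ (Ω.indicator φ) y)) ?_
    (by positivity) ?_
  · filter_upwards [Lp.coeFn_sub (H1.val (mulSmooth Ω χ hχ' (ofSmooth Ω φ hφ)))
      (T (H1.val (ofSmooth Ω φ hφ))), val_mulSmooth hχ' (ofSmooth Ω φ hφ),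
      val_ofSmooth hφ (Ω := Ω), hT _ φ (val_ofSmooth hφ)] with y h1 h2 h3 h4
    rw [h1, Pi.sub_apply, h2, h3, h4]
    ring
  · refine le_trans ?_ hDle
    rw [← eLpNorm_indicator_eq_eLpNorm_restrict hA]
    refine le_trans (eLpNorm_mono_ae ?_) (eLpNorm_mono_measure _ Measure.restrict_le_self)
    filter_upwards [ae_restrict_mem hopen.measurableSet] with y hy
    by_cases hyB : y ∈ B
    · have hmem : y ∈ Ω ∩ B := ⟨hy, hyB⟩
      rw [Set.indicator_of_mem hmem, hpt y ⟨hy, hyB⟩, norm_mul]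
      exact mul_le_of_le_one_left (norm_nonneg _) (hχ1 y)
    · rw [hχ.eq_zero hyB, zero_mul, norm_zero]
      exact norm_nonneg _

/-- A limit in operator norm of compact mollified operators; density carries the uniform bound from
smooth functions to H¹(Ω). -/
theorem isCompactOperator_val_mulSmooth (hopen : IsOpen Ω) (hbdd : Bornology.IsBounded Ω)
    (hLip : IsLipschitzSet Ω) {x : Eucl N} {r : ℝ}
    (hr : ∀ δ > 0, ∃ ψ, IsInwardMollifier Ω (Metric.ball x r) δ ψ) {χ : Eucl N → ℝ}
    (hχ : IsTestFunction (Metric.ball x r) χ) (hχ1 : ∀ y, |χ y| ≤ 1) :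
    IsCompactOperator ((H1.valL Ω).comp (mulSmooth Ω χ (hχ.mono (Set.subset_univ _)))) := by
  suffices hmem : (H1.valL Ω).comp (mulSmooth Ω χ (hχ.mono (Set.subset_univ _))) ∈
      closure {f : H1 Ω →L[ℝ] L2 Ω | IsCompactOperator f} from
    isClosed_setOfPred_isCompactOperator.closure_subset hmem
  refine (Metric.mem_closure_iff (α := H1 Ω →L[ℝ] L2 Ω)).2 fun ε hε => ?_
  obtain ⟨ψ, hψ⟩ := hr (ε / 2) (by positivity)
  obtain ⟨T, hTc, hT⟩ :=
    hψ.exists_compact_mollify hopen hbdd (hχ.mono (Set.subset_univ (Metric.ball x r)))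
  refine ⟨T.comp (H1.valL Ω), hTc.comp_clm (H1.valL Ω),
    (dist_eq_norm (E := H1 Ω →L[ℝ] L2 Ω) _ _).trans_lt ?_⟩
  refine lt_of_le_of_lt (ContinuousLinearMap.opNorm_le_bound _ (by positivity : 0 ≤ ε / 2)
    fun u => ?_) (by linarith)
  refine dense_ofSmooth hopen hbdd hLip (S := {u | ‖((H1.valL Ω).comp (mulSmooth Ω χ
    (hχ.mono (Set.subset_univ _))) - T.comp (H1.valL Ω)) u‖ ≤ ε / 2 * ‖u‖}) ?_ ?_ u
  · exact isClosed_le (ContinuousLinearMap.continuous _).norm (continuous_const.mul continuous_norm)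
  · intro φ hφ
    exact hψ.norm_sub_le hopen Metric.isOpen_ball.measurableSet (by positivity) hχ hχ1 hT hφ

/-- The Rellich theorem: the embedding of `H¹(Ω)` into `L²(Ω)` is compact. -/
theorem isCompactOperator_valL (hopen : IsOpen Ω) (hbdd : Bornology.IsBounded Ω)
    (hLip : IsLipschitzSet Ω) : IsCompactOperator (H1.valL Ω) := by
  obtain ⟨χ, hχ, hP, hone⟩ := exists_cutoff hbdd
    (P := fun χ => ∀ hχ : IsTestFunction Set.univ χ,
      IsCompactOperator ((H1.valL Ω).comp (mulSmooth Ω χ hχ)))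
    (fun h => by
      rw [mulSmooth_zero hopen, ContinuousLinearMap.comp_zero]
      exact isCompactOperator_zero)
    (fun x hx => by
      obtain ⟨r, hr, hmol⟩ := exists_inwardMollifier hopen hLip hx
      obtain ⟨χ, hχ, h1, h2⟩ := exists_local_cutoff x hr
      exact ⟨χ, hχ.mono (Set.subset_univ _),
        fun _ => isCompactOperator_val_mulSmooth hopen hbdd hLip hmol hχ h2, h1⟩)
    (fun χ₁ χ₂ h₁ h₂ p₁ p₂ h => by
      rw [mulSmooth_glue hopen h₁ h₂ h, ContinuousLinearMap.comp_sub, ContinuousLinearMap.comp_add,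
        ← ContinuousLinearMap.comp_assoc]
      exact ((p₁ h₁).add (p₂ h₂)).sub ((p₁ h₁).comp_clm _))
  have heq : (H1.valL Ω).comp (mulSmooth Ω χ hχ) = H1.valL Ω := by
    ext1 u
    rw [ContinuousLinearMap.comp_apply,
      mulSmooth_eq_self hopen hχ (fun x hx => hone x (subset_closure hx))]
  rw [← heq]
  exact hP hχ

/-! ### The form q in the abstract setting -/

theorem inner_val (u v : H1 Ω) :
    inner ℝ (H1.val u) (H1.val v) = ∫ x in Ω, H1.val u x * H1.val v x := by
  rw [L2.inner_def]
  exact integral_congr_ae (Eventually.of_forall fun x => by simp [mul_comm])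

theorem integral_eq_norm_sq (u : H1 Ω) :
    ∫ x in Ω, (‖H1.grad u x‖ ^ 2 + (H1.val u x) ^ 2) = ‖u‖ ^ 2 := by
  rw [H1.norm_sq, ← real_inner_self_eq_norm_sq (H1.val u), ← real_inner_self_eq_norm_sq (H1.grad u),
    L2.inner_def, L2.inner_def, add_comm, ← integral_add (L2.integrable_inner _ _)
      (L2.integrable_inner _ _)]
  refine integral_congr_ae (Eventually.of_forall fun x => ?_)
  simp only [real_inner_self_eq_norm_sq, Real.norm_eq_abs, sq_abs, add_comm]

/-- Multiplication by a bounded function on `L²(Ω)`. -/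
def mulBounded (Ω : Set (Eucl N)) {c : Eucl N → ℝ} (hc : MemLp c ⊤ volume) : L2 Ω →L[ℝ] L2 Ω :=
  (ContinuousLinearMap.lsmul ℝ ℝ).holderL (volume.restrict Ω) ⊤ 2 2 ((hc.restrict Ω).toLp c)

theorem coeFn_mulBounded {c : Eucl N → ℝ} (hc : MemLp c ⊤ volume) (f : L2 Ω) :
    mulBounded Ω hc f =ᵐ[volume.restrict Ω] fun x => c x * f x := by
  filter_upwards [(ContinuousLinearMap.lsmul ℝ ℝ).coeFn_holder (r := 2)
    ((hc.restrict Ω).toLp c) f, (hc.restrict Ω).coeFn_toLp] with x h1 h2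
  refine h1.trans ?_
  rw [h2]; rfl

/-- The form `q` as a continuous bilinear form. -/
def qFormL (Ω : Set (Eucl N)) {c : Eucl N → ℝ} (hc : MemLp c ⊤ volume) :
    H1 Ω →L[ℝ] H1 Ω →L[ℝ] ℝ :=
  (realInnerL (L2Vec Ω)).bilinearComp (H1.gradL Ω) (H1.gradL Ω)
    + (realInnerL (L2 Ω)).bilinearComp ((mulBounded Ω hc).comp (H1.valL Ω)) (H1.valL Ω)

theorem qFormL_eq_inner {c : Eucl N → ℝ} (hc : MemLp c ⊤ volume) (u v : H1 Ω) :
    qFormL Ω hc u v = inner ℝ (H1.grad u) (H1.grad v)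
      + inner ℝ (mulBounded Ω hc (H1.val u)) (H1.val v) := rfl

theorem qFormL_apply {c : Eucl N → ℝ} (hc : MemLp c ⊤ volume) (u v : H1 Ω) :
    qFormL Ω hc u v = qForm Ω c u v := by
  rw [qFormL_eq_inner, L2.inner_def, L2.inner_def, ← integral_add (L2.integrable_inner _ _)
    (L2.integrable_inner _ _)]
  refine integral_congr_ae ?_
  filter_upwards [coeFn_mulBounded hc (H1.val u)] with x hx
  rw [hx]
  simp [mul_comm]

theorem qFormL_symm {c : Eucl N → ℝ} (hc : MemLp c ⊤ volume) (u v : H1 Ω) :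
    qFormL Ω hc u v = qFormL Ω hc v u := by
  rw [qFormL_apply, qFormL_apply]
  refine integral_congr_ae (Eventually.of_forall fun x => ?_)
  simp only [real_inner_comm]
  ring

theorem isCoercive_qFormL {c : Eucl N → ℝ} (hc : MemLp c ⊤ volume) {c₀ : ℝ} (hc₀ : 0 < c₀)
    (hcc₀ : ∀ᵐ x ∂(volume : Measure (Eucl N)), c₀ ≤ c x) : IsCoercive (qFormL Ω hc) := by
  refine ⟨min 1 c₀, lt_min one_pos hc₀, fun u => ?_⟩
  have h1 : c₀ * ‖H1.val u‖ ^ 2 ≤ inner ℝ (mulBounded Ω hc (H1.val u)) (H1.val u) := by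
    rw [← real_inner_self_eq_norm_sq, L2.inner_def, L2.inner_def, ← integral_const_mul]
    refine integral_mono_ae ((L2.integrable_inner _ _).const_mul c₀) (L2.integrable_inner _ _) ?_
    filter_upwards [coeFn_mulBounded hc (H1.val u), ae_restrict_of_ae hcc₀] with x hx hcx
    simp only [hx, RCLike.inner_apply, conj_trivial]
    nlinarith [mul_self_nonneg (H1.val u x)]
  rw [qFormL_eq_inner, real_inner_self_eq_norm_sq, mul_assoc, ← sq, H1.norm_sq, mul_add, add_comm]
  refine add_le_add ?_ (le_trans ?_ h1)
  · exact mul_le_of_le_one_left (sq_nonneg _) (min_le_left _ _)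
  · exact mul_le_mul_of_nonneg_right (min_le_right _ _) (sq_nonneg _)

theorem isEigenfunction_iff {c : Eucl N → ℝ} (hc : MemLp c ⊤ volume) {K : Set (Eucl N)} {μ : ℝ}
    {u : H1 Ω} :
    IsEigenfunction Ω c K μ u ↔ IsFormEigenvector (qFormL Ω hc) (H1.valL Ω) (H10 Ω K) μ u := by
  simp only [IsEigenfunction, IsFormEigenvector, qFormL_apply, H1.valL_apply, inner_val]

theorem eigenvalue_eq_formEigenvalue {c : Eucl N → ℝ} (hc : MemLp c ⊤ volume) (K : Set (Eucl N))
    (n : ℕ) :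
    eigenvalue Ω c K n = formEigenvalue (qFormL Ω hc) (H1.valL Ω) (H10 Ω K) n := by
  simp only [eigenvalue, formEigenvalue, isEigenfunction_iff hc]

theorem isClosed_H10 (Ω K : Set (Eucl N)) : IsClosed (H10 Ω K : Set (H1 Ω)) :=
  Submodule.isClosed_topologicalClosure _

/-! ### Capacity and the constant function 1 -/

theorem relCapacity_eq_zero_of_H10_eq_top (hbdd : Bornology.IsBounded Ω) (hopen : IsOpen Ω)
    {K : Set (Eucl N)} (h : H10 Ω K = ⊤) : relCapacity Ω K = 0 := by
  obtain ⟨η, hη, hone⟩ := exists_smooth_eq_one hbdd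
  refine IsLeast.csInf_eq ⟨⟨0, ⟨-ofSmooth Ω η hη, by rw [h]; trivial, ?_⟩, ?_⟩, ?_⟩
  · have e1 : H1.val (-ofSmooth Ω η hη) = -H1.val (ofSmooth Ω η hη) := rfl
    have e2 : H1.val (0 : H1 Ω) = 0 := rfl
    rw [e1, e2]
    filter_upwards [Lp.coeFn_neg (H1.val (ofSmooth Ω η hη)), val_ofSmooth hη (Ω := Ω),
      Lp.coeFn_zero ℝ 2 (volume.restrict Ω), ae_restrict_mem hopen.measurableSet] with x h1 h2 h3 h4
    rw [h1, Pi.neg_apply, h2, h3, hone x h4]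
    simp
  · rw [integral_eq_norm_sq]; simp
  · rintro t ⟨u, -, rfl⟩
    rw [integral_eq_norm_sq]; positivity

theorem H10_eq_top_of_relCapacity_eq_zero (hopen : IsOpen Ω) (hbdd : Bornology.IsBounded Ω)
    (hLip : IsLipschitzSet Ω) {K : Set (Eucl N)} (h : relCapacity Ω K = 0) : H10 Ω K = ⊤ := by
  obtain ⟨η, hη, hone⟩ := exists_smooth_eq_one hbdd
  have hval := (val_ofSmooth hη (Ω := Ω)).trans
    ((ae_restrict_mem hopen.measurableSet).mono fun x hx => hone x hx :
      η =ᵐ[volume.restrict Ω] fun _ => 1)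
  have hmem : ofSmooth Ω η hη ∈ H10 Ω K := by
    refine (isClosed_H10 Ω K).closure_subset (Metric.mem_closure_iff.2 fun ε hε => ?_)
    -- The witness u = 1, w = 0 shows that the set is nonempty; this is needed because the real
    -- `sInf` of the empty set is also 0.
    obtain ⟨t, ⟨u, ⟨w, hw, hwu⟩, rfl⟩, hlt⟩ := exists_lt_of_csInf_lt
      (s := {t : ℝ | ∃ u : H1 Ω,
        (∃ w ∈ H10 Ω K, H1.val w =ᵐ[volume.restrict Ω] fun x => H1.val u x - 1) ∧
        t = ∫ x in Ω, (‖H1.grad u x‖ ^ 2 + (H1.val u x) ^ 2)})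
      ⟨_, ofSmooth Ω η hη, ⟨0, Submodule.zero_mem _, by
        have e : H1.val (0 : H1 Ω) = 0 := rfl
        rw [e]
        filter_upwards [hval, Lp.coeFn_zero ℝ 2 (volume.restrict Ω)] with x h1 h2
        rw [h1, h2]; simp⟩, rfl⟩
      (h.trans_lt (by positivity : 0 < ε ^ 2))
    refine ⟨-w, Submodule.neg_mem _ hw, ?_⟩
    -- Since w = u - 1, the distance from 1 to -w is ‖u‖, which is below ε.
    have hw' : w = u - ofSmooth Ω η hη := by
      refine H1.ext_ae hopen (hwu.trans ?_)
      have e : H1.val (u - ofSmooth Ω η hη) = H1.val u - H1.val (ofSmooth Ω η hη) := rfl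
      rw [e]
      filter_upwards [hval, Lp.coeFn_sub (H1.val u) (H1.val (ofSmooth Ω η hη))] with x h1 h2
      rw [h2, Pi.sub_apply, h1]
    rw [integral_eq_norm_sq] at hlt
    rw [dist_eq_norm, hw', sub_neg_eq_add, add_sub_cancel]
    exact lt_of_pow_lt_pow_left₀ 2 hε.le hlt
  refine Submodule.eq_top_iff'.2 fun u =>
    dense_ofSmooth hopen hbdd hLip (isClosed_H10 Ω K) (fun φ hφ => ?_) u
  have heq : mulSmooth Ω φ hφ (ofSmooth Ω η hη) = ofSmooth Ω φ hφ := by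
    refine H1.ext_ae hopen ?_
    filter_upwards [val_mulSmooth hφ (ofSmooth Ω η hη), hval, val_ofSmooth hφ (Ω := Ω)]
      with x h1 h2 h3
    rw [h1, h2, h3, mul_one]
  rw [← heq]
  exact mulSmooth_mem_H10 hopen hφ hmem

end MixedEigen

end

open MixedEigen in
theorem mainTheorem7 (N : ℕ) (hN : 2 ≤ N) (Ω : Set (Eucl N)) (hopen : IsOpen Ω)
    (hbdd : Bornology.IsBounded Ω) (hconn : IsConnected Ω) (hLip : IsLipschitzSet Ω)
    (c : Eucl N → ℝ) (hc : MemLp c ⊤ volume) (c₀ : ℝ) (hc₀ : 0 < c₀)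
    (hcc₀ : ∀ᵐ x ∂(volume : Measure (Eucl N)), c₀ ≤ c x)
    (K : Set (Eucl N)) (hK : IsCompact K) (hKΩ : K ⊆ closure Ω) :
    List.TFAE [
      relCapacity Ω K = 0,
      H10 Ω K = ⊤,
      ∀ n : ℕ, 1 ≤ n → eigenvalue Ω c K n = eigenvalue Ω c ∅ n] := by
  tfae_have 1 → 2 := H10_eq_top_of_relCapacity_eq_zero hopen hbdd hLip
  tfae_have 2 → 1 := relCapacity_eq_zero_of_H10_eq_top hbdd hopen
  tfae_have 2 → 3 := fun h n _ => by
    rw [eigenvalue_eq_formEigenvalue hc, eigenvalue_eq_formEigenvalue hc, h,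
      H10_empty hopen hbdd hLip]
  tfae_have 3 → 2 := fun h => by
    -- Density identifies the case K = ∅ with the full form on H¹(Ω), the comparison space of the
    -- abstract theorem.
    refine eq_top_of_formEigenvalue_eq (qFormL_symm hc) (isCoercive_qFormL hc hc₀ hcc₀)
      (isCompactOperator_valL hopen hbdd hLip) (H1.val_injective hopen) (isClosed_H10 Ω K)
      fun n hn => ?_
    rw [← eigenvalue_eq_formEigenvalue hc, h n hn, eigenvalue_eq_formEigenvalue hc,
      H10_empty hopen hbdd hLip]
  tfae_finish
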